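/- Let $N\ge 1$, let $\Omega\subset\mathbb R^N$ be a nonempty bounded open set (no regularity of $\partial\Omega$ is assumed), let $\Gamma\subseteq\partial\Omega$ be closed, and let $1<p<\infty$. Let $\rho\in C_c^\infty(\mathbb R^N)$ be radially symmetric with $0\le\rho\le 1$, $\rho(x)=0\iff |x|\ge 1$, and $\rho(x)\ge\rho(y)$ whenever $|x|<1/2$ and $|y|=1/2$. Let $\eta\in C^\infty(\mathbb R^N)$ be nonnegative with $\eta^{-1}(\{0\})=\partial\Omega$, with all derivatives of $\eta$ vanishing on $\partial\Omega$, and with $\eta(x)<\mathrm{dist}(x,\partial\Omega)$ for every $x\in\mathbb R^N\setminus\partial\Omega$. For $f\in L^1_{loc}(\Omega)$, $x\in\Omega$ and $n\ge 1$ put $$Tf(x)=M_\rho\int_{B_1(0)}\rho(z)\,f(x-\eta(x)z)\,dz,\qquad T_nf(x)=M_\rho\int_{B_1(0)}\rho(z)\,f\Big(x-\frac{\eta(x)}{n}z\Big)\,dz,\qquad M_\rho=\Big(\int_{B_1(0)}\rho(y)\,dy\Big)^{-1}.$$ Let $W^{1,p}_\Gamma(\Omega)$ be the closure in $W^{1,p}(\Omega)$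 of $\{w\in C^\infty(\Omega)\cap W^{1,p}(\Omega):\ \mathrm{supp}(w)\cap\Gamma=\emptyset\}$, where $\mathrm{supp}(w)$ is the closure of $\{x\in\Omega: w(x)\ne 0\}$ in $\mathbb R^N$; it carries the norm of $W^{1,p}(\Omega)$. Then $T$ is a bounded linear operator from $W^{1,p}_\Gamma(\Omega)$ to itself. Moreover, for every $f\in W^{1,p}_\Gamma(\Omega)$ one has $T_nf\in W^{1,p}_\Gamma(\Omega)$ for all $n\ge 1$, and $T_nf\to f$ in $W^{1,p}_\Gamma(\Omega)$ as $n\to\infty$. -/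

import Mathlib

open MeasureTheory Set Filter Topology
open scoped ENNReal ContDiff

noncomputable section

/-- `ℝ^N` with the Euclidean norm and Lebesgue measure. -/
abbrev Eucl (N : ℕ) : Type := EuclideanSpace ℝ (Fin N)

/-! ### The kernel `ρ`, the step function `η`, and the variable step mollifier -/

/-- The admissible kernels `ρ ∈ C_c^∞(ℝ^N)`.  Compactness of the support follows from
`eq_zero_iff`. -/
structure IsMollifierKernel {N : ℕ} (ρ : Eucl N → ℝ) : Prop where
  smooth : ContDiff ℝ ∞ ρ
  nonneg : ∀ x, 0 ≤ ρ x
  le_one : ∀ x, ρ x ≤ 1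
  eq_zero_iff : ∀ x, ρ x = 0 ↔ 1 ≤ ‖x‖
  radial : ∀ x y, ‖x‖ = ‖y‖ → ρ x = ρ y
  half_le : ∀ x y, ‖x‖ < 1 / 2 → ‖y‖ = 1 / 2 → ρ y ≤ ρ x

/-- `η` is a nonnegative smooth function on `ℝ^N` which vanishes exactly on the (nonempty, closed)
set `Θ`, together with all its derivatives, and is smaller than the distance to `Θ` off `Θ`. -/
structure IsStepFunction {N : ℕ} (Θ : Set (Eucl N)) (η : Eucl N → ℝ) : Prop where
  smooth : ContDiff ℝ ∞ η
  nonneg : ∀ x, 0 ≤ η x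
  eq_zero_iff : ∀ x, η x = 0 ↔ x ∈ Θ
  iteratedFDeriv_eq_zero : ∀ x ∈ Θ, ∀ k : ℕ, iteratedFDeriv ℝ k η x = 0
  lt_dist : ∀ x, x ∉ Θ → η x < Metric.infDist x Θ

/-- `M_ρ = (∫_{B_1(0)} ρ)⁻¹`. -/
def kernelConst {N : ℕ} (ρ : Eucl N → ℝ) : ℝ :=
  (∫ y in Metric.ball (0 : Eucl N) 1, ρ y)⁻¹

/-- `T f (x) = M_ρ ∫_{B_1(0)} ρ(z) f(x - η(x) z) dz`. -/
def variableMollify {N : ℕ} (ρ η : Eucl N → ℝ) (f : Eucl N → ℝ) (x : Eucl N) : ℝ :=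
  kernelConst ρ * ∫ z in Metric.ball (0 : Eucl N) 1, ρ z * f (x - η x • z)

/-- `T_n f (x) = M_ρ ∫_{B_1(0)} ρ(z) f(x - (η(x) / n) z) dz`, for `n ≥ 1`. -/
def variableMollifySeq {N : ℕ} (ρ η : Eucl N → ℝ) (n : ℕ) (f : Eucl N → ℝ) (x : Eucl N) : ℝ :=
  kernelConst ρ * ∫ z in Metric.ball (0 : Eucl N) 1, ρ z * f (x - (η x / n) • z)

/-! ### Sobolev spaces -/

/-- `g` is the weak gradient of `u` on `Ω`: for every test function `φ ∈ C_c^∞(Ω)` and every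
direction `v`, `∫_Ω u ∂_v φ = - ∫_Ω φ (g · v)`. -/
def IsWeakGradient {N : ℕ} (Ω : Set (Eucl N)) (u : Eucl N → ℝ) (g : Eucl N → Eucl N) : Prop :=
  ∀ φ : Eucl N → ℝ, ContDiff ℝ ∞ φ → HasCompactSupport φ → tsupport φ ⊆ Ω → ∀ v : Eucl N,
    ∫ x in Ω, u x * fderiv ℝ φ x v = - ∫ x in Ω, φ x * inner ℝ (g x) v

section Aux

variable {N : ℕ} {Ω : Set (Eucl N)} {p : ℝ≥0∞} [Fact (1 ≤ p)]

theorem integrable_mul_test {u : Eucl N → ℝ} (hu : MemLp u p (volume.restrict Ω))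
    {ψ : Eucl N → ℝ} (hψ : Continuous ψ) (hc : HasCompactSupport ψ) :
    Integrable (fun x => u x * ψ x) (volume.restrict Ω) := by
  have hloc : LocallyIntegrable u (volume.restrict Ω) := hu.locallyIntegrable Fact.out
  have := hloc.integrable_smul_left_of_hasCompactSupport hψ hc
  simpa [smul_eq_mul, mul_comm] using this

theorem integrable_test_mul_inner {g : Eucl N → Eucl N} (hg : MemLp g p (volume.restrict Ω))
    {φ : Eucl N → ℝ} (hφ : Continuous φ) (hc : HasCompactSupport φ) (v : Eucl N) :
    Integrable (fun x => φ x * inner ℝ (g x) v) (volume.restrict Ω) := by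
  have hg' : MemLp (fun x => inner ℝ (g x) v) p (volume.restrict Ω) := hg.inner_const v
  simpa [mul_comm] using integrable_mul_test hg' hφ hc

theorem IsWeakGradient.congr {u u' : Eucl N → ℝ} {g g' : Eucl N → Eucl N}
    (h : IsWeakGradient Ω u g) (hu : u' =ᵐ[volume.restrict Ω] u)
    (hg : g' =ᵐ[volume.restrict Ω] g) : IsWeakGradient Ω u' g' := by
  intro φ h1 h2 h3 v
  have e1 : ∫ x in Ω, u' x * fderiv ℝ φ x v = ∫ x in Ω, u x * fderiv ℝ φ x v :=
    integral_congr_ae (hu.mono fun x hx => by simp only [hx])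
  have e2 : ∫ x in Ω, φ x * inner ℝ (g' x) v = ∫ x in Ω, φ x * inner ℝ (g x) v :=
    integral_congr_ae (hg.mono fun x hx => by simp only [hx])
  rw [e1, e2]
  exact h φ h1 h2 h3 v

theorem IsWeakGradient.add {u u' : Eucl N → ℝ} {g g' : Eucl N → Eucl N}
    (hu : MemLp u p (volume.restrict Ω)) (hu' : MemLp u' p (volume.restrict Ω))
    (hg : MemLp g p (volume.restrict Ω)) (hg' : MemLp g' p (volume.restrict Ω))
    (h : IsWeakGradient Ω u g) (h' : IsWeakGradient Ω u' g') :
    IsWeakGradient Ω (u + u') (g + g') := by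
  intro φ h1 h2 h3 v
  have hd : Continuous fun x => fderiv ℝ φ x v :=
    (h1.continuous_fderiv (by simp)).clm_apply continuous_const
  have hdc : HasCompactSupport fun x => fderiv ℝ φ x v := h2.fderiv_apply (𝕜 := ℝ) v
  simp only [Pi.add_apply, add_mul, inner_add_left, mul_add]
  rw [integral_add (integrable_mul_test hu hd hdc) (integrable_mul_test hu' hd hdc),
    integral_add (integrable_test_mul_inner hg h1.continuous h2 v)
      (integrable_test_mul_inner hg' h1.continuous h2 v), h φ h1 h2 h3 v, h' φ h1 h2 h3 v]
  ring

theorem IsWeakGradient.const_smul {u : Eucl N → ℝ} {g : Eucl N → Eucl N}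
    (h : IsWeakGradient Ω u g) (c : ℝ) : IsWeakGradient Ω (c • u) (c • g) := by
  intro φ h1 h2 h3 v
  simp only [Pi.smul_apply, smul_eq_mul, inner_smul_left, mul_assoc, mul_left_comm,
    integral_const_mul, RCLike.conj_to_real]
  rw [h φ h1 h2 h3 v]
  ring

end Aux

/-- The ambient space `L^p(Ω) × L^p(Ω; ℝ^N)` with the norm
`‖(u, g)‖ = (‖u‖_p ^ p + ‖g‖_p ^ p) ^ (1 / p)` (for `p < ∞`). -/
abbrev LpPair {N : ℕ} (Ω : Set (Eucl N)) (p : ℝ≥0∞) : Type :=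
  WithLp p (Lp ℝ p (volume.restrict Ω) × Lp (Eucl N) p (volume.restrict Ω))

/-- The Sobolev space `W^{1,p}(Ω)`: an element is a function in `L^p(Ω)` together with its weak
gradient in `L^p(Ω; ℝ^N)`; it carries the usual Sobolev norm
`(‖u‖_p ^ p + ‖∇u‖_p ^ p) ^ (1 / p)`. -/
def SobolevW1 {N : ℕ} (Ω : Set (Eucl N)) (p : ℝ≥0∞) [Fact (1 ≤ p)] :
    Submodule ℝ (LpPair Ω p) where
  carrier := {w | IsWeakGradient Ω w.fst w.snd}
  zero_mem' := by
    have h : IsWeakGradient Ω (0 : Eucl N → ℝ) (0 : Eucl N → Eucl N) := by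
      intro φ _ _ _ v
      simp
    exact h.congr (Lp.coeFn_zero ..) (Lp.coeFn_zero ..)
  add_mem' := by
    intro a b ha hb
    exact (IsWeakGradient.add (Lp.memLp a.fst) (Lp.memLp b.fst) (Lp.memLp a.snd)
      (Lp.memLp b.snd) ha hb).congr (Lp.coeFn_add ..) (Lp.coeFn_add ..)
  smul_mem' := by
    intro c a ha
    exact (IsWeakGradient.const_smul ha c).congr (Lp.coeFn_smul ..) (Lp.coeFn_smul ..)

/-- The function `f` is a representative of the Sobolev function `w`, i.e. `f = w` a.e. on `Ω`
(the values of `f` off `Ω` play no role). -/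
def Represents {N : ℕ} {Ω : Set (Eucl N)} {p : ℝ≥0∞} [Fact (1 ≤ p)]
    (f : Eucl N → ℝ) (w : SobolevW1 Ω p) : Prop :=
  f =ᵐ[volume.restrict Ω] (w : LpPair Ω p).fst

/-- The support of a function on `Ω`: the closure in `ℝ^N` of `{x ∈ Ω | f x ≠ 0}`. -/
def supportIn {N : ℕ} (Ω : Set (Eucl N)) (f : Eucl N → ℝ) : Set (Eucl N) :=
  closure {x | x ∈ Ω ∧ f x ≠ 0}

/-- The functions `w ∈ W^{1,p}(Ω) ∩ C^∞(Ω)` with `supp w ∩ Γ = ∅`. -/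
def smoothOffSubmodule {N : ℕ} (Ω : Set (Eucl N)) (p : ℝ≥0∞) [Fact (1 ≤ p)]
    (Γ : Set (Eucl N)) : Submodule ℝ (SobolevW1 Ω p) where
  carrier := {w | ∃ f : Eucl N → ℝ,
    ContDiffOn ℝ ∞ f Ω ∧ supportIn Ω f ∩ Γ = ∅ ∧ Represents f w}
  zero_mem' := by
    refine ⟨0, contDiffOn_const, by simp [supportIn], ?_⟩
    exact (Lp.coeFn_zero ..).symm
  add_mem' := by
    rintro a b ⟨f, hf, hfΓ, hfa⟩ ⟨g, hg, hgΓ, hgb⟩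
    refine ⟨f + g, hf.add hg, ?_, ?_⟩
    · have hsub : supportIn Ω (f + g) ⊆ supportIn Ω f ∪ supportIn Ω g := by
        unfold supportIn
        rw [← closure_union]
        refine closure_mono ?_
        rintro x ⟨hx, hne⟩
        by_cases h : f x = 0
        · refine Or.inr ⟨hx, fun h' => hne (by simp [h, h'])⟩
        · exact Or.inl ⟨hx, h⟩
      refine Set.eq_empty_of_subset_empty ?_
      rintro x ⟨hx, hxΓ⟩
      rcases hsub hx with h | h
      · exact hfΓ ▸ (⟨h, hxΓ⟩ : x ∈ supportIn Ω f ∩ Γ)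
      · exact hgΓ ▸ (⟨h, hxΓ⟩ : x ∈ supportIn Ω g ∩ Γ)
    · exact (hfa.add hgb).trans (Lp.coeFn_add ..).symm
  smul_mem' := by
    rintro c a ⟨f, hf, hfΓ, hfa⟩
    refine ⟨c • f, hf.const_smul c, ?_, ?_⟩
    · have hsub : supportIn Ω (c • f) ⊆ supportIn Ω f := by
        refine closure_mono ?_
        rintro x ⟨hx, hne⟩
        exact ⟨hx, fun h' => hne (by simp [h'])⟩
      refine Set.eq_empty_of_subset_empty ?_
      rintro x ⟨hx, hxΓ⟩
      exact hfΓ ▸ (⟨hsub hx, hxΓ⟩ : x ∈ supportIn Ω f ∩ Γ)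
    · exact (hfa.const_smul c).trans (Lp.coeFn_smul ..).symm

/-- `W_Γ^{1,p}(Ω)`: the closure in `W^{1,p}(Ω)` of the smooth functions with
`supp w ∩ Γ = ∅`, with the norm of `W^{1,p}(Ω)`. -/
def SobolevW1Off {N : ℕ} (Ω : Set (Eucl N)) (p : ℝ≥0∞) [Fact (1 ≤ p)]
    (Γ : Set (Eucl N)) : Submodule ℝ (SobolevW1 Ω p) :=
  (smoothOffSubmodule Ω p Γ).topologicalClosure

end

/-! Write `h` for the step, either `η` or `η / n`. Since `h` is smaller than the distance to `∂Ω`,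
the ball of radius `h x` about `x ∈ Ω` lies in `Ω`, and the substitution `y = x - h(x) z` turns the
mollification into `∫_Ω k(x, y) f(y) dy` with `k(x, y) = M_ρ h(x)^{-N} ρ((x - y) / h(x))`. For `f`
of class `C^1`, differentiating under the integral gives the gradient `∫_Ω k(x, y) P(x, (x - y) /
h(x)) ∇f(y) dy`, where `P(x, z) g = g - ⟨z, g⟩ ∇h(x)`. So the function and its gradient are each
moved by an integral operator that makes sense on all of `L^p`.

Both operators are bounded by the Schur test (`lintegral_kernel_rpow_le`). The integral of `k` in
`y` is `1`. The integral in `x` is the real issue, and it needs no regularity of the boundary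
(`exists_lintegral_stepKernel_left_le`): `∇h` vanishes on the compact set `∂Ω`, so close to it `h`
varies slowly and `h x`, `h y` are comparable wherever `k(x, y) ≠ 0`; away from it `h` is bounded
below.

The pair of operators preserves the smooth functions with support off `Γ` (`toLp_mem_smoothOff`):
derivatives can be put on the kernel, and the average at `x` only sees points closer to `x` than any
boundary point is. As `W^{1,p}(Ω)` is closed in `L^p × L^p`, the pair restricts to the closure of
these functions.

For convergence (`tendsto_of_weightedKernel`), the step `η / n` is 1/2-Lipschitz on `Ω` for large
`n`, so the operator norms are bounded uniformly in `n`, and `P_n` tends to the identity uniformly.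
Convergence is then checked on continuous functions of compact support and extended by density. -/

section SchurTest

/-! ### The Schur test for operator-valued kernels -/

variable {X Y E F : Type*} [MeasurableSpace X] [MeasurableSpace Y]
  {μ : Measure X} {ν : Measure Y}

/-- **Schur test** for nonnegative functions. -/
theorem lintegral_kernel_rpow_le [SFinite μ] [SFinite ν] {k : X → Y → ℝ≥0∞}
    (hk : Measurable (Function.uncurry k)) {f : Y → ℝ≥0∞} (hf : AEMeasurable f ν)
    {p : ℝ} (hp : 1 < p) {A B : ℝ≥0∞}
    (hA : ∀ᵐ x ∂μ, ∫⁻ y, k x y ∂ν ≤ A) (hB : ∀ᵐ y ∂ν, ∫⁻ x, k x y ∂μ ≤ B) :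
    ∫⁻ x, (∫⁻ y, k x y * f y ∂ν) ^ p ∂μ ≤ A ^ (p - 1) * B * ∫⁻ y, f y ^ p ∂ν := by
  have hp0 : 0 < p := by linarith
  have hpq := Real.HolderConjugate.conjExponent hp
  set q := p.conjExponent
  have hq0 : 0 < q := hpq.symm.pos
  have hkx : ∀ x, Measurable (k x) := fun x => hk.comp measurable_prodMk_left
  have key : ∀ᵐ x ∂μ, (∫⁻ y, k x y * f y ∂ν) ^ p ≤ A ^ (p - 1) * ∫⁻ y, k x y * f y ^ p ∂ν := by
    filter_upwards [hA] with x hx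
    -- Hölder for the splitting `k f = (k^(1/p) f) * k^(1/q)`; the second factor is controlled by
    -- `A`.
    have h1 := ENNReal.lintegral_mul_le_Lp_mul_Lq ν hpq
      (f := fun y => k x y ^ (1 / p) * f y) (g := fun y => k x y ^ (1 / q))
      (((hkx x).aemeasurable.pow_const _).mul hf) ((hkx x).aemeasurable.pow_const _)
    have h2 : ∀ y, ((fun y => k x y ^ (1 / p) * f y) * fun y => k x y ^ (1 / q)) y
        = k x y * f y := by
      intro y
      simp only [Pi.mul_apply]
      rw [mul_right_comm, ← ENNReal.rpow_add_of_nonneg _ _ (by positivity) (by positivity),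
        one_div, one_div, hpq.inv_add_inv_eq_one, ENNReal.rpow_one]
    have h3 : ∀ y, (k x y ^ (1 / p) * f y) ^ p = k x y * f y ^ p := by
      intro y
      rw [ENNReal.mul_rpow_of_nonneg _ _ hp0.le, ← ENNReal.rpow_mul, one_div_mul_cancel hp0.ne',
        ENNReal.rpow_one]
    have h4 : ∀ y, (k x y ^ (1 / q)) ^ q = k x y := by
      intro y
      rw [← ENNReal.rpow_mul, one_div_mul_cancel hq0.ne', ENNReal.rpow_one]
    simp only [h2, h3, h4] at h1
    calc (∫⁻ y, k x y * f y ∂ν) ^ p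
        ≤ ((∫⁻ y, k x y * f y ^ p ∂ν) ^ (1 / p) * (∫⁻ y, k x y ∂ν) ^ (1 / q)) ^ p := by gcongr
      _ = (∫⁻ y, k x y * f y ^ p ∂ν) * (∫⁻ y, k x y ∂ν) ^ (p - 1) := by
          rw [ENNReal.mul_rpow_of_nonneg _ _ hp0.le, ← ENNReal.rpow_mul, ← ENNReal.rpow_mul,
            one_div_mul_cancel hp0.ne', ENNReal.rpow_one, one_div, ← div_eq_inv_mul,
            hpq.div_conj_eq_sub_one]
      _ ≤ (∫⁻ y, k x y * f y ^ p ∂ν) * A ^ (p - 1) := by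
          gcongr
      _ = _ := mul_comm _ _
  have hmeas : AEMeasurable (Function.uncurry fun x y => k x y * f y ^ p) (μ.prod ν) :=
    hk.aemeasurable.mul ((hf.pow_const p).comp_snd)
  -- Integrate the pointwise bound in `x`; after Tonelli the inner integral is that of `k` in `x`,
  -- controlled by `B`.
  calc ∫⁻ x, (∫⁻ y, k x y * f y ∂ν) ^ p ∂μ
      ≤ ∫⁻ x, A ^ (p - 1) * ∫⁻ y, k x y * f y ^ p ∂ν ∂μ := lintegral_mono_ae key
    _ = A ^ (p - 1) * ∫⁻ y, (∫⁻ x, k x y ∂μ) * f y ^ p ∂ν := by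
        rw [lintegral_const_mul'' (A ^ (p - 1)) (f := fun x => ∫⁻ y, k x y * f y ^ p ∂ν)
          hmeas.lintegral_prod_right', lintegral_lintegral_swap hmeas]
        congr 1
        refine lintegral_congr fun y => ?_
        exact lintegral_mul_const _ (hk.comp measurable_prodMk_right)
    _ ≤ A ^ (p - 1) * ∫⁻ y, B * f y ^ p ∂ν := by
        refine mul_le_mul_right (lintegral_mono_ae ?_) _
        filter_upwards [hB] with y hy
        gcongr
    _ = _ := by rw [lintegral_const_mul'' _ (hf.pow_const p), mul_assoc]

variable [NormedAddCommGroup E] [NormedSpace ℝ E] [NormedAddCommGroup F] [NormedSpace ℝ F]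

/-- A measurable operator-valued kernel dominated by a scalar kernel satisfying the bounds of the
Schur test. -/
structure IsSchurKernel (μ : Measure X) (ν : Measure Y) (K : X → Y → E →L[ℝ] F)
    (k : X → Y → ℝ≥0∞) (A B : ℝ≥0∞) : Prop where
  stronglyMeasurable : StronglyMeasurable (Function.uncurry K)
  measurable : Measurable (Function.uncurry k)
  enorm_le : ∀ᵐ x ∂μ, ∀ y, ‖K x y‖ₑ ≤ k x y
  lintegral_left : ∀ᵐ x ∂μ, ∫⁻ y, k x y ∂ν ≤ A
  lintegral_right : ∀ᵐ y ∂ν, ∫⁻ x, k x y ∂μ ≤ B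

namespace IsSchurKernel

variable {K : X → Y → E →L[ℝ] F} {k : X → Y → ℝ≥0∞} {A B : ℝ≥0∞} {p : ℝ≥0∞}

theorem enorm_apply_le (h : IsSchurKernel μ ν K k A B) :
    ∀ᵐ x ∂μ, ∀ y, ∀ e : E, ‖K x y e‖ₑ ≤ k x y * ‖e‖ₑ := by
  filter_upwards [h.enorm_le] with x hx y e
  exact ((K x y).le_opENorm e).trans (by gcongr; exact hx y)

theorem aestronglyMeasurable_apply [SFinite ν] (h : IsSchurKernel μ ν K k A B) {f : Y → E}
    (hf : AEStronglyMeasurable f ν) :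
    AEStronglyMeasurable (fun z : X × Y => K z.1 z.2 (f z.2)) (μ.prod ν) :=
  isBoundedBilinearMap_apply.continuous.comp_aestronglyMeasurable
    (StronglyMeasurable.aestronglyMeasurable h.stronglyMeasurable |>.prodMk hf.comp_snd)

theorem aestronglyMeasurable_integral [SFinite ν] (h : IsSchurKernel μ ν K k A B) {f : Y → E}
    (hf : AEStronglyMeasurable f ν) :
    AEStronglyMeasurable (fun x => ∫ y, K x y (f y) ∂ν) μ :=
  (h.aestronglyMeasurable_apply hf).integral_prod_right'

theorem lintegral_rpow_le [SFinite μ] [SFinite ν] (h : IsSchurKernel μ ν K k A B) {f : Y → E}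
    (hf : AEStronglyMeasurable f ν) (hp : 1 < p) (hp' : p ≠ ⊤) :
    ∫⁻ x, (∫⁻ y, k x y * ‖f y‖ₑ ∂ν) ^ p.toReal ∂μ
      ≤ A ^ (p.toReal - 1) * B * eLpNorm f p ν ^ p.toReal := by
  have hp1 : 1 < p.toReal := by
    rw [← ENNReal.toReal_one]; exact (ENNReal.toReal_lt_toReal (by simp) hp').2 hp
  have hp0 : p ≠ 0 := (zero_lt_one.trans hp).ne'
  rw [eLpNorm_eq_lintegral_rpow_enorm_toReal hp0 hp', ← ENNReal.rpow_mul,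
    one_div_mul_cancel (by linarith), ENNReal.rpow_one]
  exact lintegral_kernel_rpow_le h.measurable hf.enorm hp1 h.lintegral_left h.lintegral_right

/-- **Schur test** in `L^p` for operator-valued kernels. -/
theorem eLpNorm_integral_le [SFinite μ] [SFinite ν] (h : IsSchurKernel μ ν K k A B) {f : Y → E}
    (hf : AEStronglyMeasurable f ν) (hp : 1 < p) (hp' : p ≠ ⊤) :
    eLpNorm (fun x => ∫ y, K x y (f y) ∂ν) p μ
      ≤ (A ^ (p.toReal - 1) * B) ^ (1 / p.toReal) * eLpNorm f p ν := by
  have hp1 : 1 < p.toReal := by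
    rw [← ENNReal.toReal_one]; exact (ENNReal.toReal_lt_toReal (by simp) hp').2 hp
  have hp0 : p ≠ 0 := (zero_lt_one.trans hp).ne'
  rw [eLpNorm_eq_lintegral_rpow_enorm_toReal hp0 hp']
  calc (∫⁻ x, ‖∫ y, K x y (f y) ∂ν‖ₑ ^ p.toReal ∂μ) ^ (1 / p.toReal)
      ≤ (A ^ (p.toReal - 1) * B * eLpNorm f p ν ^ p.toReal) ^ (1 / p.toReal) := by
        gcongr
        refine le_trans (lintegral_mono_ae ?_) (h.lintegral_rpow_le hf hp hp')
        filter_upwards [h.enorm_apply_le] with x hx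
        gcongr
        exact (enorm_integral_le_lintegral_enorm _).trans (lintegral_mono fun y => hx y _)
    _ = _ := by
        rw [ENNReal.mul_rpow_of_nonneg _ _ (by positivity), ← ENNReal.rpow_mul (eLpNorm f p ν),
          mul_one_div_cancel (by linarith), ENNReal.rpow_one]

/-- The Schur bound makes the dominating integral finite for almost every `x`. Additivity of the
operator depends on this, since Bochner integrals only add when both integrands are integrable. -/
theorem ae_integrable [SFinite μ] [SFinite ν] (h : IsSchurKernel μ ν K k A B) (hA : A ≠ ⊤)
    (hB : B ≠ ⊤) {f : Y → E} (hf : MemLp f p ν) (hp : 1 < p) (hp' : p ≠ ⊤) :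
    ∀ᵐ x ∂μ, Integrable (fun y => K x y (f y)) ν := by
  have hp1 : 1 < p.toReal := by
    rw [← ENNReal.toReal_one]; exact (ENNReal.toReal_lt_toReal (by simp) hp').2 hp
  have hfin : ∫⁻ x, (∫⁻ y, k x y * ‖f y‖ₑ ∂ν) ^ p.toReal ∂μ ≠ ⊤ := by
    refine ne_top_of_le_ne_top ?_ (h.lintegral_rpow_le hf.1 hp hp')
    exact ENNReal.mul_ne_top (ENNReal.mul_ne_top
      (ENNReal.rpow_ne_top_of_nonneg (by linarith) hA) hB)
      (ENNReal.rpow_ne_top_of_nonneg (by linarith) hf.2.ne)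
  have hmeas : AEMeasurable (fun x => (∫⁻ y, k x y * ‖f y‖ₑ ∂ν) ^ p.toReal) μ := by
    refine AEMeasurable.pow_const ?_ _
    exact (h.measurable.aemeasurable.mul hf.1.enorm.comp_snd).lintegral_prod_right'
  have hm := (h.aestronglyMeasurable_apply (μ := μ) hf.1).prodMk_left
  filter_upwards [ae_lt_top' hmeas hfin, h.enorm_apply_le, hm] with x hx hx' hx''
  refine ⟨hx'', ?_⟩
  have : ∫⁻ y, k x y * ‖f y‖ₑ ∂ν < ⊤ := by
    by_contra hc
    rw [not_lt, top_le_iff] at hc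
    rw [hc, ENNReal.top_rpow_of_pos (by linarith)] at hx
    exact lt_irrefl _ hx
  exact (lintegral_mono fun y => hx' y (f y)).trans_lt this

theorem memLp_integral [SFinite μ] [SFinite ν] (h : IsSchurKernel μ ν K k A B) (hA : A ≠ ⊤)
    (hB : B ≠ ⊤) {f : Y → E} (hf : MemLp f p ν) (hp : 1 < p) (hp' : p ≠ ⊤) :
    MemLp (fun x => ∫ y, K x y (f y) ∂ν) p μ := by
  have hp1 : 1 < p.toReal := by
    rw [← ENNReal.toReal_one]; exact (ENNReal.toReal_lt_toReal (by simp) hp').2 hp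
  refine ⟨h.aestronglyMeasurable_integral hf.1, (h.eLpNorm_integral_le hf.1 hp hp').trans_lt ?_⟩
  refine ENNReal.mul_lt_top (ENNReal.rpow_lt_top_of_nonneg (by positivity) ?_) hf.2
  exact ENNReal.mul_ne_top (ENNReal.rpow_ne_top_of_nonneg (by linarith) hA) hB

/-- The bounded operator on `L^p` given by a kernel satisfying the bounds of the Schur test. -/
theorem exists_clm [SFinite μ] [SFinite ν] [Fact (1 ≤ p)] (h : IsSchurKernel μ ν K k A B)
    (hA : A ≠ ⊤) (hB : B ≠ ⊤) (hp : 1 < p) (hp' : p ≠ ⊤) :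
    ∃ S : Lp E p ν →L[ℝ] Lp F p μ,
      (∀ f : Lp E p ν, S f =ᵐ[μ] fun x => ∫ y, K x y (f y) ∂ν) ∧
      ∀ f, ‖S f‖ ≤ ((A ^ (p.toReal - 1) * B) ^ (1 / p.toReal)).toReal * ‖f‖ := by
  have hp1 : 1 < p.toReal := by
    rw [← ENNReal.toReal_one]; exact (ENNReal.toReal_lt_toReal (by simp) hp').2 hp
  have hC : (A ^ (p.toReal - 1) * B) ^ (1 / p.toReal) ≠ ⊤ :=
    ENNReal.rpow_ne_top_of_nonneg (by positivity)
      (ENNReal.mul_ne_top (ENNReal.rpow_ne_top_of_nonneg (by linarith) hA) hB)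
  let S₀ : Lp E p ν →ₗ[ℝ] Lp F p μ :=
    { toFun := fun f => (h.memLp_integral hA hB (Lp.memLp f) hp hp').toLp _
      map_add' := by
        intro f g
        rw [← MemLp.toLp_add]
        refine MemLp.toLp_congr _ _ ?_
        filter_upwards [h.ae_integrable hA hB (Lp.memLp f) hp hp',
          h.ae_integrable hA hB (Lp.memLp g) hp hp'] with x h1 h2
        rw [Pi.add_apply, ← integral_add h1 h2]
        refine integral_congr_ae ?_
        filter_upwards [Lp.coeFn_add f g] with y hy
        rw [hy, Pi.add_apply, map_add]
      map_smul' := by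
        intro c f
        rw [RingHom.id_apply, ← MemLp.toLp_const_smul]
        refine MemLp.toLp_congr _ _ (Eventually.of_forall fun x => ?_)
        rw [Pi.smul_apply, ← integral_smul]
        refine integral_congr_ae ?_
        filter_upwards [Lp.coeFn_smul c f] with y hy
        rw [hy, Pi.smul_apply, map_smul] }
  have hS : ∀ f, ‖S₀ f‖ ≤ ((A ^ (p.toReal - 1) * B) ^ (1 / p.toReal)).toReal * ‖f‖ := by
    intro f
    change ‖(h.memLp_integral hA hB (Lp.memLp f) hp hp').toLp _‖ ≤ _
    rw [Lp.norm_toLp, Lp.norm_def, ← ENNReal.toReal_mul]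
    exact ENNReal.toReal_mono (ENNReal.mul_ne_top hC (Lp.memLp f).2.ne)
      (h.eLpNorm_integral_le (Lp.memLp f).1 hp hp')
  exact ⟨S₀.mkContinuous _ hS, fun f =>
    MemLp.coeFn_toLp (h.memLp_integral hA hB (Lp.memLp f) hp hp'), hS⟩

end IsSchurKernel

end SchurTest

/-! ### The variable step kernel and elementary properties of the step -/

noncomputable section

variable {N : ℕ}

section Kernel

variable {ρ : Eucl N → ℝ}

namespace IsMollifierKernel

theorem eq_zero (hρ : IsMollifierKernel ρ) {z : Eucl N} (hz : 1 ≤ ‖z‖) : ρ z = 0 :=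
  (hρ.eq_zero_iff z).2 hz

theorem continuous (hρ : IsMollifierKernel ρ) : Continuous ρ := hρ.smooth.continuous

theorem hasCompactSupport (hρ : IsMollifierKernel ρ) : HasCompactSupport ρ := by
  refine HasCompactSupport.of_support_subset_isCompact (isCompact_closedBall (0 : Eucl N) 1) ?_
  intro z hz
  by_contra h
  rw [mem_closedBall_zero_iff, not_le] at h
  exact hz (hρ.eq_zero h.le)

theorem setIntegral_smul {E : Type*} [NormedAddCommGroup E] [NormedSpace ℝ E]
    (hρ : IsMollifierKernel ρ) (F : Eucl N → E) :
    ∫ z in Metric.ball (0 : Eucl N) 1, ρ z • F z = ∫ z, ρ z • F z := by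
  refine setIntegral_eq_integral_of_forall_compl_eq_zero fun z hz => ?_
  rw [mem_ball_zero_iff, not_lt] at hz
  rw [hρ.eq_zero hz, zero_smul]

theorem integral_pos (hρ : IsMollifierKernel ρ) : 0 < ∫ z, ρ z := by
  refine hρ.continuous.integral_pos_of_hasCompactSupport_nonneg_nonzero hρ.hasCompactSupport
    hρ.nonneg (x := 0) ?_
  rw [Ne, hρ.eq_zero_iff]
  simp

theorem kernelConst_eq (hρ : IsMollifierKernel ρ) : kernelConst ρ = (∫ z, ρ z)⁻¹ := by
  rw [kernelConst]
  congr 1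
  simpa using hρ.setIntegral_smul (fun _ => (1 : ℝ))

theorem kernelConst_pos (hρ : IsMollifierKernel ρ) : 0 < kernelConst ρ := by
  rw [hρ.kernelConst_eq]
  exact inv_pos.2 hρ.integral_pos

end IsMollifierKernel

/-- The kernel `(x, y) ↦ M_ρ h(x)^{-N} ρ((x - y) / h(x))` of mollification with variable step
`h`. -/
def stepKernel (ρ h : Eucl N → ℝ) (x y : Eucl N) : ℝ :=
  kernelConst ρ * (h x ^ N)⁻¹ * ρ ((h x)⁻¹ • (x - y))

variable {h : Eucl N → ℝ}

theorem measurable_stepKernel (hρ : IsMollifierKernel ρ) (hh : Measurable h) :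
    Measurable (Function.uncurry (stepKernel ρ h)) := by
  have hρm := hρ.continuous.measurable
  unfold stepKernel Function.uncurry
  fun_prop

theorem stepKernel_nonneg (hρ : IsMollifierKernel ρ) {x y : Eucl N} (hx : 0 ≤ h x) :
    0 ≤ stepKernel ρ h x y := by
  have := hρ.kernelConst_pos
  have := hρ.nonneg ((h x)⁻¹ • (x - y))
  unfold stepKernel
  positivity

theorem stepKernel_le (hρ : IsMollifierKernel ρ) {x y : Eucl N} (hx : 0 ≤ h x) :
    stepKernel ρ h x y ≤ kernelConst ρ * (h x ^ N)⁻¹ := by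
  have := hρ.kernelConst_pos
  unfold stepKernel
  exact mul_le_of_le_one_right (by positivity) (hρ.le_one _)

theorem stepKernel_eq_zero (hρ : IsMollifierKernel ρ) {x y : Eucl N} (hx : 0 < h x)
    (hxy : h x ≤ ‖x - y‖) : stepKernel ρ h x y = 0 := by
  unfold stepKernel
  rw [hρ.eq_zero, mul_zero]
  rw [norm_smul, norm_inv, Real.norm_of_nonneg hx.le, inv_mul_eq_div, one_le_div hx]
  exact hxy

/-- Passing from the average over the unit ball to the integral against `stepKernel`. -/
theorem kernelConst_smul_setIntegral_eq {E : Type*} [NormedAddCommGroup E] [NormedSpace ℝ E]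
    (hρ : IsMollifierKernel ρ) {x : Eucl N} (hx : 0 < h x) (F : Eucl N → E) :
    kernelConst ρ • ∫ z in Metric.ball (0 : Eucl N) 1, ρ z • F (x - h x • z)
      = ∫ y, stepKernel ρ h x y • F y := by
  rw [hρ.setIntegral_smul fun z => F (x - h x • z)]
  have h1 : ∀ z, ρ z • F (x - h x • z)
      = (fun w => ρ ((h x)⁻¹ • w) • F (x - w)) (h x • z) := by
    intro z
    simp [smul_smul, inv_mul_cancel₀ hx.ne']
  -- Translate by `w = x - y` first; the dilation `w = h(x) z` then produces the Jacobian `h(x)^N`.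
  have h2 : ∫ y, stepKernel ρ h x y • F y
      = ∫ w, (kernelConst ρ * (h x ^ N)⁻¹) • (ρ ((h x)⁻¹ • w) • F (x - w)) := by
    rw [← integral_sub_left_eq_self _ _ x]
    simp [stepKernel, smul_smul]
  rw [h2, integral_smul, mul_smul]
  rw [integral_congr_ae (Eventually.of_forall h1), 
    Measure.integral_comp_smul volume (fun w => ρ ((h x)⁻¹ • w) • F (x - w)) (h x)]
  simp [abs_of_pos hx]

end Kernel

section StepFunction

variable {Ω : Set (Eucl N)} {h : Eucl N → ℝ}

namespace IsStepFunction

theorem pos (hh : IsStepFunction (frontier Ω) h) (hΩ : IsOpen Ω) {x : Eucl N} (hx : x ∈ Ω) :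
    0 < h x := by
  refine (hh.nonneg x).lt_of_ne fun h0 => ?_
  have := (hh.eq_zero_iff x).1 h0.symm
  rw [hΩ.frontier_eq] at this
  exact this.2 hx

theorem lt_infDist (hh : IsStepFunction (frontier Ω) h) (hΩ : IsOpen Ω) {x : Eucl N}
    (hx : x ∈ Ω) : h x < Metric.infDist x (frontier Ω) := by
  refine hh.lt_dist x fun hx' => ?_
  rw [hΩ.frontier_eq] at hx'
  exact hx'.2 hx

/-- The ball is connected and too small to meet the frontier, so it cannot leave `Ω` for the
complement of its closure. -/
theorem closedBall_subset (hh : IsStepFunction (frontier Ω) h) (hΩ : IsOpen Ω) {x : Eucl N}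
    (hx : x ∈ Ω) : Metric.closedBall x (h x) ⊆ Ω := by
  have hd : Disjoint Ω (closure Ω)ᶜ := disjoint_compl_right_iff_subset.2 subset_closure
  refine (convex_closedBall x (h x)).isPreconnected.subset_left_of_subset_union hΩ
    isClosed_closure.isOpen_compl hd (fun z hz => ?_)
    ⟨x, Metric.mem_closedBall_self (hh.nonneg x), hx⟩
  by_contra hz'
  rw [mem_union, mem_compl_iff, not_or, not_not] at hz'
  have hzf : z ∈ frontier Ω := by rw [hΩ.frontier_eq]; exact ⟨hz'.2, hz'.1⟩
  have h1 := hh.lt_infDist hΩ hx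
  have h2 := Metric.infDist_le_dist_of_mem (x := x) hzf
  rw [Metric.mem_closedBall, dist_comm] at hz
  linarith

/-- `Metric.infDist` to the empty set is `0` by convention, so an empty frontier would force `h x <
0`. -/
theorem frontier_nonempty (hh : IsStepFunction (frontier Ω) h) (hΩ : IsOpen Ω)
    (hΩn : Ω.Nonempty) : (frontier Ω).Nonempty := by
  obtain ⟨x, hx⟩ := hΩn
  by_contra hne
  rw [not_nonempty_iff_eq_empty] at hne
  have h1 := hh.lt_infDist hΩ hx
  rw [hne, Metric.infDist_empty] at h1
  exact absurd (hh.nonneg x) (not_le.2 h1)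

/-- This makes `T_n` an instance of `T`, with step `η / n`. -/
theorem div_nat {Θ : Set (Eucl N)} (hh : IsStepFunction Θ h) {n : ℕ} (hn : 1 ≤ n) :
    IsStepFunction Θ fun x => h x / n := by
  have hn' : (1 : ℝ) ≤ n := by exact_mod_cast hn
  have heq : (fun x => h x / (n : ℝ)) = (n : ℝ)⁻¹ • h := by
    ext x
    simp [div_eq_inv_mul]
  refine ⟨hh.smooth.div_const _, fun x => div_nonneg (hh.nonneg x) (by positivity),
    fun x => ?_, fun x hx k => ?_, fun x hx => ?_⟩
  · rw [div_eq_zero_iff, hh.eq_zero_iff]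
    simp only [or_iff_left_iff_imp]
    intro h0
    linarith
  · rw [heq, iteratedFDeriv_const_smul_apply
      (hh.smooth.of_le (by exact_mod_cast le_top)).contDiffAt, hh.iteratedFDeriv_eq_zero x hx, smul_zero]
  · exact (div_le_self (hh.nonneg x) hn').trans_lt (hh.lt_dist x hx)

theorem fderiv_eq_zero {Θ : Set (Eucl N)} (hh : IsStepFunction Θ h) {x : Eucl N} (hx : x ∈ Θ) :
    fderiv ℝ h x = 0 := by
  have := hh.iteratedFDeriv_eq_zero x hx 1
  rw [← norm_eq_zero, ← norm_iteratedFDeriv_one, this, norm_zero]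

end IsStepFunction

end StepFunction

end

/-! ### Integral bounds for the kernel in each variable -/

noncomputable section

variable {N : ℕ} {ρ : Eucl N → ℝ} {Ω : Set (Eucl N)} {h : Eucl N → ℝ}

namespace IsStepFunction

theorem measurable {Θ : Set (Eucl N)} (hh : IsStepFunction Θ h) : Measurable h :=
  hh.smooth.continuous.measurable

theorem stepKernel_eq_zero_of_notMem (hh : IsStepFunction (frontier Ω) h) (hΩ : IsOpen Ω)
    (hρ : IsMollifierKernel ρ) {x y : Eucl N} (hx : x ∈ Ω) (hy : y ∉ Ω) :
    stepKernel ρ h x y = 0 := by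
  refine stepKernel_eq_zero hρ (hh.pos hΩ hx) ?_
  by_contra hlt
  rw [not_le, ← dist_eq_norm, dist_comm] at hlt
  exact hy (hh.closedBall_subset hΩ hx hlt.le)

/-- Passing from the average over the unit ball to the integral against `stepKernel`. -/
theorem kernelConst_smul_setIntegral (hh : IsStepFunction (frontier Ω) h) (hΩ : IsOpen Ω)
    (hρ : IsMollifierKernel ρ) {E : Type*} [NormedAddCommGroup E] [NormedSpace ℝ E]
    {x : Eucl N} (hx : x ∈ Ω) (F : Eucl N → E) :
    kernelConst ρ • ∫ z in Metric.ball (0 : Eucl N) 1, ρ z • F (x - h x • z)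
      = ∫ y in Ω, stepKernel ρ h x y • F y := by
  rw [kernelConst_smul_setIntegral_eq hρ (hh.pos hΩ hx),
    setIntegral_eq_integral_of_forall_compl_eq_zero]
  intro y hy
  rw [hh.stepKernel_eq_zero_of_notMem hΩ hρ hx hy, zero_smul]

theorem setIntegral_stepKernel (hh : IsStepFunction (frontier Ω) h) (hΩ : IsOpen Ω)
    (hρ : IsMollifierKernel ρ) {x : Eucl N} (hx : x ∈ Ω) :
    ∫ y in Ω, stepKernel ρ h x y = 1 := by
  have h1 := hh.kernelConst_smul_setIntegral hΩ hρ hx (fun _ => (1 : ℝ))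
  simp only [smul_eq_mul, mul_one] at h1
  rw [← h1, kernelConst]
  have h2 := hρ.kernelConst_pos
  rw [kernelConst] at h2
  exact inv_mul_cancel₀ (inv_pos.1 h2).ne'

theorem setLIntegral_stepKernel (hh : IsStepFunction (frontier Ω) h) (hΩ : IsOpen Ω)
    (hρ : IsMollifierKernel ρ) {x : Eucl N} (hx : x ∈ Ω) :
    ∫⁻ y in Ω, ENNReal.ofReal (stepKernel ρ h x y) = 1 := by
  have h1 := hh.setIntegral_stepKernel hΩ hρ hx
  have hi : Integrable (stepKernel ρ h x) (volume.restrict Ω) := by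
    -- A non-integrable function would have Bochner integral `0`, not `1`.
    by_contra hc
    rw [integral_undef hc] at h1
    exact zero_ne_one h1
  rw [← ofReal_integral_eq_lintegral_ofReal hi
    (Eventually.of_forall fun y => stepKernel_nonneg hρ (hh.nonneg x)), h1, ENNReal.ofReal_one]

/-- If the variation of the step `h` is controlled on `D`, the kernel `stepKernel` has bounded
integral over `D` in its first variable. -/
theorem setLIntegral_stepKernel_left_le (hh : IsStepFunction (frontier Ω) h) (hΩ : IsOpen Ω)
    (hρ : IsMollifierKernel ρ) {D : Set (Eucl N)} (hD : D ⊆ Ω) (hDm : MeasurableSet D)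
    (hlip : ∀ x ∈ D, ∀ y ∈ Ω, dist x y < h x → |h x - h y| ≤ 1 / 2 * dist x y)
    {y : Eucl N} (hy : y ∈ Ω) :
    ∫⁻ x in D, ENNReal.ofReal (stepKernel ρ h x y)
      ≤ ENNReal.ofReal (kernelConst ρ * 3 ^ N) * volume (Metric.ball (0 : Eucl N) 1) := by
  have hy0 := hh.pos hΩ hy
  have hM := hρ.kernelConst_pos
  -- If the kernel is nonzero then `dist x y < h x`, so `hlip` gives `|h x - h y| < h x / 2`. Hence
  -- `h x < 2 h y`, which places `x` in the ball, and `h y < (3/2) h x`, which bounds `1 / h x`.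
  -- Multiplying by the volume of the ball, `(3/2)^N * 2^N = 3^N` and the powers of `h y` cancel.
  have key : ∀ x ∈ D, ENNReal.ofReal (stepKernel ρ h x y)
      ≤ (Metric.ball y (2 * h y)).indicator
        (fun _ => ENNReal.ofReal (kernelConst ρ * (3 / 2 / h y) ^ N)) x := by
    intro x hx
    have hx0 := hh.pos hΩ (hD hx)
    by_cases hxy : dist x y < h x
    · have h1 := abs_le.1 (hlip x hx y hy hxy)
      have hmem : x ∈ Metric.ball y (2 * h y) := by
        rw [Metric.mem_ball]; linarith
      rw [indicator_of_mem hmem]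
      refine ENNReal.ofReal_le_ofReal ((stepKernel_le hρ hx0.le).trans ?_)
      rw [← inv_pow]
      gcongr
      rw [inv_le_comm₀ hx0 (by positivity), inv_div, div_le_iff₀ (by norm_num)]
      linarith
    · rw [stepKernel_eq_zero hρ hx0 (by rw [← dist_eq_norm]; exact not_lt.1 hxy),
        ENNReal.ofReal_zero]
      exact zero_le
  calc ∫⁻ x in D, ENNReal.ofReal (stepKernel ρ h x y)
      ≤ ∫⁻ x in D, (Metric.ball y (2 * h y)).indicator
        (fun _ => ENNReal.ofReal (kernelConst ρ * (3 / 2 / h y) ^ N)) x :=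
        setLIntegral_mono' hDm key
    _ ≤ ∫⁻ x, (Metric.ball y (2 * h y)).indicator
        (fun _ => ENNReal.ofReal (kernelConst ρ * (3 / 2 / h y) ^ N)) x :=
        setLIntegral_le_lintegral _ _
    _ = ENNReal.ofReal (kernelConst ρ * (3 / 2 / h y) ^ N)
          * volume (Metric.ball y (2 * h y)) := by
        rw [lintegral_indicator_const Metric.isOpen_ball.measurableSet]
    _ = _ := by
        rw [Measure.addHaar_ball_of_pos _ _ (by positivity), ← mul_assoc,
          ← ENNReal.ofReal_mul (by positivity), finrank_euclideanSpace_fin, mul_assoc, ← mul_pow]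
        congr 4
        field_simp

/-- The gradient of `h` vanishes on the compact frontier, so it has norm below 1/2 on a whole
thickening of it. Both `x` and `y` lie in one ball about a frontier point inside that thickening,
and the mean value inequality applies there. -/
theorem exists_thickening_lipschitz (hh : IsStepFunction (frontier Ω) h) (hΩ : IsOpen Ω)
    (hΩb : Bornology.IsBounded Ω) :
    ∃ δ > 0, ∀ x ∈ Ω, Metric.infDist x (frontier Ω) < δ → ∀ y, dist x y < h x →
      |h x - h y| ≤ 1 / 2 * dist x y := by
  have hcont : Continuous fun x => ‖fderiv ℝ h x‖ := (hh.smooth.continuous_fderiv (by simp)).norm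
  have hcomp : IsCompact (frontier Ω) :=
    Metric.isCompact_of_isClosed_isBounded isClosed_frontier
      (hΩb.closure.subset frontier_subset_closure)
  obtain ⟨δ, hδ, hsub⟩ := hcomp.exists_thickening_subset_open
    (isOpen_Iio.preimage hcont : IsOpen ((fun x => ‖fderiv ℝ h x‖) ⁻¹' Iio (1 / 2)))
    (fun x hx => by simp [hh.fderiv_eq_zero hx])
  -- Half of `δ` suffices: `dist x y < h x`, which is less than the distance from `x` to the
  -- frontier, so `y` is within `δ / 2 + δ / 2` of `b`.
  refine ⟨δ / 2, by positivity, fun x hx hxd y hxy => ?_⟩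
  have hne := hh.frontier_nonempty hΩ ⟨x, hx⟩
  obtain ⟨b, hb, hxb⟩ := (Metric.infDist_lt_iff hne).1 hxd
  have hxy' := hxy.trans (hh.lt_infDist hΩ hx)
  have hball : Metric.ball b δ ⊆ (fun x => ‖fderiv ℝ h x‖) ⁻¹' Iio (1 / 2) :=
    (Metric.ball_subset_thickening hb δ).trans hsub
  have := (convex_ball b δ).norm_image_sub_le_of_norm_fderiv_le (𝕜 := ℝ) (f := h) (C := 1 / 2)
    (x := y) (y := x)
    (fun z _ => (hh.smooth.differentiable (by simp)).differentiableAt)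
    (fun z hz => (hball hz).le)
    (by
      rw [Metric.mem_ball]
      have := dist_triangle_left y b x
      linarith)
    (by rw [Metric.mem_ball]; linarith)
  rwa [Real.norm_eq_abs, ← dist_eq_norm] at this

/-- Near the frontier the slow variation of `h` gives the bound. On the rest of `Ω`, whose closure
avoids the frontier, compactness gives `h ≥ m > 0`; the kernel is then bounded, and `Ω` has finite
measure. -/
theorem exists_lintegral_stepKernel_left_le (hh : IsStepFunction (frontier Ω) h) (hΩ : IsOpen Ω)
    (hΩb : Bornology.IsBounded Ω) (hρ : IsMollifierKernel ρ) :
    ∃ B : ℝ≥0∞, B ≠ ⊤ ∧ ∀ y ∈ Ω, ∫⁻ x in Ω, ENNReal.ofReal (stepKernel ρ h x y) ≤ B := by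
  obtain ⟨δ, hδ, hlip⟩ := hh.exists_thickening_lipschitz hΩ hΩb
  have hdc : Continuous fun x => Metric.infDist x (frontier Ω) := Metric.continuous_infDist_pt _
  set V : Set (Eucl N) := {x | Metric.infDist x (frontier Ω) < δ} with hV
  have hVo : IsOpen V := isOpen_lt hdc continuous_const
  have hcomp : IsCompact (closure Ω ∩ Vᶜ) :=
    (Metric.isCompact_of_isClosed_isBounded isClosed_closure hΩb.closure).inter_right
      hVo.isClosed_compl
  have hpos : ∃ m > 0, ∀ x ∈ closure Ω ∩ Vᶜ, m ≤ h x := by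
    rcases (closure Ω ∩ Vᶜ).eq_empty_or_nonempty with he | hne
    · exact ⟨1, one_pos, by simp [he]⟩
    · obtain ⟨x, hx, hmin⟩ := hcomp.exists_isMinOn hne hh.smooth.continuous.continuousOn
      refine ⟨h x, (hh.nonneg x).lt_of_ne fun h0 => ?_, fun y hy => hmin hy⟩
      have hxf := (hh.eq_zero_iff x).1 h0.symm
      refine hx.2 ?_
      rw [hV, mem_ofPred_eq, Metric.infDist_zero_of_mem hxf]
      exact hδ
  obtain ⟨m, hm, hmle⟩ := hpos
  have hM := hρ.kernelConst_pos
  refine ⟨ENNReal.ofReal (kernelConst ρ * 3 ^ N) * volume (Metric.ball (0 : Eucl N) 1)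
    + ENNReal.ofReal (kernelConst ρ * (m ^ N)⁻¹) * volume Ω, ?_, fun y hy => ?_⟩
  · exact ENNReal.add_ne_top.2 ⟨ENNReal.mul_ne_top ENNReal.ofReal_ne_top measure_ball_lt_top.ne,
      ENNReal.mul_ne_top ENNReal.ofReal_ne_top hΩb.measure_lt_top.ne⟩
  · have hsub : Ω ⊆ (Ω ∩ V) ∪ (Ω ∩ Vᶜ) := by rw [← inter_union_distrib_left]; simp
    refine (lintegral_mono_set hsub).trans ((lintegral_union_le _ _ _).trans ?_)
    gcongr
    · exact hh.setLIntegral_stepKernel_left_le hΩ hρ inter_subset_left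
        (hΩ.inter hVo).measurableSet (fun x hx y _ hxy => hlip x hx.1 hx.2 y hxy) hy
    · calc ∫⁻ x in Ω ∩ Vᶜ, ENNReal.ofReal (stepKernel ρ h x y)
          ≤ ∫⁻ x in Ω ∩ Vᶜ, ENNReal.ofReal (kernelConst ρ * (m ^ N)⁻¹) := by
            refine setLIntegral_mono' (hΩ.measurableSet.inter hVo.measurableSet.compl)
              fun x hx => ENNReal.ofReal_le_ofReal ((stepKernel_le hρ (hh.nonneg x)).trans ?_)
            have := hmle x ⟨subset_closure hx.1, hx.2⟩
            gcongr
        _ = ENNReal.ofReal (kernelConst ρ * (m ^ N)⁻¹) * volume (Ω ∩ Vᶜ) :=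
            setLIntegral_const _ _
        _ ≤ _ := by gcongr; exact inter_subset_left

/-- The step `h` and its derivative are bounded on a bounded set. -/
theorem exists_bound_fderiv {Θ : Set (Eucl N)} (hh : IsStepFunction Θ h)
    (hΩb : Bornology.IsBounded Ω) :
    ∃ C > 0, (∀ x ∈ Ω, h x ≤ C) ∧ (∀ x ∈ Ω, ‖fderiv ℝ h x‖ ≤ C) ∧
      ∀ x ∈ Ω, ∀ y ∈ Ω, |h x - h y| ≤ C * dist x y := by
  have hcont : Continuous fun x => ‖fderiv ℝ h x‖ := (hh.smooth.continuous_fderiv (by simp)).norm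
  -- The mean value inequality needs a convex set, so the derivative is bounded on a ball containing
  -- `Ω`.
  obtain ⟨R, hR⟩ := hΩb.subset_closedBall (0 : Eucl N)
  obtain ⟨C₁, hC₁⟩ := (isCompact_closedBall (0 : Eucl N) R).bddAbove_image
    hh.smooth.continuous.continuousOn
  obtain ⟨C₂, hC₂⟩ := (isCompact_closedBall (0 : Eucl N) R).bddAbove_image hcont.continuousOn
  refine ⟨max 1 (max C₁ C₂), by positivity, fun x hx => ?_, fun x hx => ?_, fun x hx y hy => ?_⟩
  · exact (hC₁ (mem_image_of_mem _ (hR hx))).trans ((le_max_left _ _).trans (le_max_right _ _))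
  · exact (hC₂ (mem_image_of_mem (fun x => ‖fderiv ℝ h x‖) (hR hx))).trans
      ((le_max_right _ _).trans (le_max_right _ _))
  · have := (convex_closedBall (0 : Eucl N) R).norm_image_sub_le_of_norm_fderiv_le (𝕜 := ℝ)
      (f := h) (C := max 1 (max C₁ C₂)) (x := y) (y := x)
      (fun z _ => (hh.smooth.differentiable (by simp)).differentiableAt)
      (fun z hz => (hC₂ (mem_image_of_mem (fun x => ‖fderiv ℝ h x‖) hz)).trans
        ((le_max_right _ _).trans (le_max_right _ _))) (hR hy) (hR hx)
    rwa [Real.norm_eq_abs, ← dist_eq_norm] at this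

end IsStepFunction

end

/-! ### Weighted kernels and convergence to the identity -/

noncomputable section

variable {N : ℕ} {ρ : Eucl N → ℝ} {Ω : Set (Eucl N)} {h : Eucl N → ℝ}
  {E : Type*} [NormedAddCommGroup E] [NormedSpace ℝ E]

/-- The operator-valued kernel `(x, y) ↦ k(x, y) P(x, (x - y) / h(x))`, where `k` is
`stepKernel ρ h`. -/
def weightedKernel (ρ h : Eucl N → ℝ) (P : Eucl N → Eucl N → E →L[ℝ] E) (x y : Eucl N) :
    E →L[ℝ] E :=
  stepKernel ρ h x y • P x ((h x)⁻¹ • (x - y))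

theorem norm_inv_smul_lt_one (hρ : IsMollifierKernel ρ) {x y : Eucl N}
    (hk : stepKernel ρ h x y ≠ 0) : ‖(h x)⁻¹ • (x - y)‖ < 1 := by
  by_contra hc
  refine hk ?_
  rw [stepKernel, hρ.eq_zero (not_lt.1 hc), mul_zero]

namespace IsStepFunction

theorem setIntegral_weightedKernel (hh : IsStepFunction (frontier Ω) h) (hΩ : IsOpen Ω)
    (hρ : IsMollifierKernel ρ) (P : Eucl N → Eucl N → E →L[ℝ] E) {x : Eucl N} (hx : x ∈ Ω)
    (f : Eucl N → E) :
    ∫ y in Ω, weightedKernel ρ h P x y (f y)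
      = kernelConst ρ • ∫ z in Metric.ball (0 : Eucl N) 1, ρ z • P x z (f (x - h x • z)) := by
  have h0 := (hh.pos hΩ hx).ne'
  have := hh.kernelConst_smul_setIntegral hΩ hρ hx (fun y => P x ((h x)⁻¹ • (x - y)) (f y))
  simp only [sub_sub_cancel, smul_smul, inv_mul_cancel₀ h0, one_smul] at this
  rw [this]
  rfl

theorem isSchurKernel_weightedKernel (hh : IsStepFunction (frontier Ω) h) (hΩ : IsOpen Ω)
    (hρ : IsMollifierKernel ρ) {P : Eucl N → Eucl N → E →L[ℝ] E}
    (hP : Continuous (Function.uncurry P)) {C : ℝ}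
    (hC : ∀ x ∈ Ω, ∀ z, ‖z‖ < 1 → ‖P x z‖ ≤ C) {B : ℝ≥0∞}
    (hB : ∀ y ∈ Ω, ∫⁻ x in Ω, ENNReal.ofReal (stepKernel ρ h x y) ≤ B) :
    IsSchurKernel (volume.restrict Ω) (volume.restrict Ω) (weightedKernel ρ h P)
      (fun x y => ENNReal.ofReal C * ENNReal.ofReal (stepKernel ρ h x y))
      (ENNReal.ofReal C) (ENNReal.ofReal C * B) := by
  have hkm := measurable_stepKernel hρ hh.measurable
  have hkm' : Measurable fun q : Eucl N × Eucl N => ENNReal.ofReal (stepKernel ρ h q.1 q.2) :=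
    hkm.ennreal_ofReal
  have hhm := hh.measurable
  refine ⟨?_, hkm'.const_mul _, ?_, ?_, ?_⟩
  · have hm : Measurable fun q : Eucl N × Eucl N => (q.1, (h q.1)⁻¹ • (q.1 - q.2)) := by fun_prop
    exact hkm.stronglyMeasurable.smul (hP.comp_stronglyMeasurable hm.stronglyMeasurable)
  · filter_upwards [ae_restrict_mem hΩ.measurableSet] with x hx y
    by_cases hk : stepKernel ρ h x y = 0
    · rw [weightedKernel, hk, zero_smul, ← ofReal_norm, norm_zero, ENNReal.ofReal_zero]
      exact zero_le
    · rw [weightedKernel, enorm_smul, mul_comm,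
        Real.enorm_eq_ofReal (stepKernel_nonneg hρ (hh.nonneg x)), ← ofReal_norm]
      gcongr
      exact hC x hx _ (norm_inv_smul_lt_one hρ hk)
  · filter_upwards [ae_restrict_mem hΩ.measurableSet] with x hx
    rw [lintegral_const_mul (f := fun y => ENNReal.ofReal (stepKernel ρ h x y)) _
      (hkm'.comp measurable_prodMk_left), hh.setLIntegral_stepKernel hΩ hρ hx, mul_one]
  · filter_upwards [ae_restrict_mem hΩ.measurableSet] with y hy
    rw [lintegral_const_mul (f := fun x => ENNReal.ofReal (stepKernel ρ h x y)) _
      (hkm'.comp measurable_prodMk_right)]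
    gcongr
    exact hB y hy

/-- If `P(x, z)` is close to the identity, the operator with kernel `weightedKernel ρ h P` is
close to the identity on uniformly continuous functions. -/
theorem norm_setIntegral_weightedKernel_sub_le [CompleteSpace E]
    (hh : IsStepFunction (frontier Ω) h) (hΩ : IsOpen Ω) (hρ : IsMollifierKernel ρ)
    {P : Eucl N → Eucl N → E →L[ℝ] E} {ε κ G : ℝ} {x : Eucl N} (hx : x ∈ Ω)
    (hP : ∀ z, ‖z‖ < 1 → ‖P x z - ContinuousLinearMap.id ℝ E‖ ≤ ε) {g : Eucl N → E}
    (hG : ∀ y, ‖g y‖ ≤ G) (hg : ∀ y, dist x y < h x → ‖g y - g x‖ ≤ κ)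
    (hi : IntegrableOn (fun y => weightedKernel ρ h P x y (g y)) Ω) :
    ‖(∫ y in Ω, weightedKernel ρ h P x y (g y)) - g x‖ ≤ ε * G + κ := by
  have h1 := hh.setIntegral_stepKernel hΩ hρ hx
  have hk : IntegrableOn (stepKernel ρ h x) Ω := by
    by_contra hc
    rw [integral_undef hc] at h1
    exact zero_ne_one h1
  -- As the kernel has mass one, `g x` and the constant bound can both be written as integrals
  -- against it, reducing the estimate to one on integrands.
  have h2 : ∫ y in Ω, stepKernel ρ h x y • g x = g x := by
    rw [integral_smul_const, h1, one_smul]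
  have h3 : ∫ y in Ω, stepKernel ρ h x y * (ε * G + κ) = ε * G + κ := by
    rw [integral_mul_const, h1, one_mul]
  nth_rewrite 1 [← h2]
  rw [← integral_sub hi (hk.smul_const _), ← h3]
  refine norm_integral_le_of_norm_le (hk.mul_const _) (Eventually.of_forall fun y => ?_)
  have hk0 := stepKernel_nonneg (y := y) hρ (hh.nonneg x)
  by_cases hk : stepKernel ρ h x y = 0
  · simp [weightedKernel, hk]
  · have hz := norm_inv_smul_lt_one hρ hk
    have hxy : dist x y < h x := by
      by_contra hc
      exact hk (stepKernel_eq_zero hρ (hh.pos hΩ hx) (by rw [← dist_eq_norm]; exact not_lt.1 hc))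
    set z := (h x)⁻¹ • (x - y) with hzdef
    have hsplit : weightedKernel ρ h P x y (g y) - stepKernel ρ h x y • g x
        = stepKernel ρ h x y • ((P x z - ContinuousLinearMap.id ℝ E) (g y) + (g y - g x)) := by
      simp only [weightedKernel, smul_apply, sub_apply,
        ContinuousLinearMap.id_apply, sub_add_sub_cancel, smul_sub, ← hzdef]
    rw [hsplit, norm_smul, Real.norm_of_nonneg hk0]
    gcongr
    refine (norm_add_le _ _).trans (add_le_add ?_ (hg y hxy))
    refine ((P x z - ContinuousLinearMap.id ℝ E).le_opNorm (g y)).trans ?_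
    have := hP z hz
    have hε : 0 ≤ ε := (norm_nonneg _).trans this
    gcongr
    exact hG y

end IsStepFunction

/-- Convergence to the identity of operators with kernels `weightedKernel`, with step tending to
zero and factor tending to the identity. -/
theorem tendsto_of_weightedKernel [CompleteSpace E] (hΩ : IsOpen Ω)
    (hΩb : Bornology.IsBounded Ω) (hρ : IsMollifierKernel ρ) {p : ℝ≥0∞} [Fact (1 ≤ p)]
    (hp : 1 < p) (hp' : p ≠ ⊤) {hs : ℕ → Eucl N → ℝ}
    (hh : ∀ᶠ n in atTop, IsStepFunction (frontier Ω) (hs n))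
    {P : ℕ → Eucl N → Eucl N → E →L[ℝ] E} (hPc : ∀ᶠ n in atTop, Continuous (Function.uncurry (P n)))
    {ε τ : ℕ → ℝ} (hε : Tendsto ε atTop (𝓝 0)) (hτ : Tendsto τ atTop (𝓝 0))
    (hhτ : ∀ᶠ n in atTop, ∀ x ∈ Ω, hs n x ≤ τ n)
    (hP : ∀ᶠ n in atTop, ∀ x ∈ Ω, ∀ z, ‖z‖ < 1 →
      ‖P n x z - ContinuousLinearMap.id ℝ E‖ ≤ ε n)
    {B : ℝ≥0∞} (hBt : B ≠ ⊤)
    (hB : ∀ᶠ n in atTop, ∀ y ∈ Ω, ∫⁻ x in Ω, ENNReal.ofReal (stepKernel ρ (hs n) x y) ≤ B)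
    {S : ℕ → Lp E p (volume.restrict Ω) →L[ℝ] Lp E p (volume.restrict Ω)}
    (hS : ∀ᶠ n in atTop, ∀ f : Lp E p (volume.restrict Ω), S n f =ᵐ[volume.restrict Ω]
      fun x => ∫ y in Ω, weightedKernel ρ (hs n) (P n) x y (f y))
    (f : Lp E p (volume.restrict Ω)) : Tendsto (fun n => S n f) atTop (𝓝 f) := by
  have : IsFiniteMeasure (volume.restrict Ω) :=
    ⟨by rw [Measure.restrict_apply_univ]; exact hΩb.measure_lt_top⟩
  have hp1 : 1 < p.toReal := by
    rw [← ENNReal.toReal_one]; exact (ENNReal.toReal_lt_toReal (by simp) hp').2 hp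
  -- uniform boundedness of the operators
  set A : ℝ≥0∞ := ENNReal.ofReal 2 with hA
  have hAt : A ≠ ⊤ := ENNReal.ofReal_ne_top
  set C : ℝ := ((A ^ (p.toReal - 1) * (A * B)) ^ (1 / p.toReal)).toReal with hC
  have hC0 : 0 ≤ C := ENNReal.toReal_nonneg
  have hschur : ∀ᶠ n in atTop, IsSchurKernel (volume.restrict Ω) (volume.restrict Ω)
      (weightedKernel ρ (hs n) (P n))
      (fun x y => ENNReal.ofReal 2 * ENNReal.ofReal (stepKernel ρ (hs n) x y)) A (A * B) := by
    filter_upwards [hh, hB, hε.eventually (gt_mem_nhds one_pos), hP, hPc] with n h1 h2 h3 hP hPc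
    refine h1.isSchurKernel_weightedKernel hΩ hρ hPc (fun x hx z hz => ?_) h2
    have h4 := hP x hx z hz
    have h5 : ‖ContinuousLinearMap.id ℝ E‖ ≤ 1 := ContinuousLinearMap.norm_id_le
    have h6 := norm_add_le (P n x z - ContinuousLinearMap.id ℝ E) (ContinuousLinearMap.id ℝ E)
    rw [sub_add_cancel] at h6
    linarith
  have hbound : ∀ᶠ n in atTop, ∀ u : Lp E p (volume.restrict Ω), ‖S n u‖ ≤ C * ‖u‖ := by
    filter_upwards [hschur, hS] with n h1 h2 u
    -- `S n` is only known through its kernel formula; it agrees with the Schur operator and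
    -- inherits its norm bound.
    obtain ⟨S', hS', hn⟩ := h1.exists_clm hAt (ENNReal.mul_ne_top hAt hBt) hp hp'
    have : S n u = S' u := Lp.ext ((h2 u).trans (hS' u).symm)
    rw [this]
    exact hn u
  rw [Metric.tendsto_atTop']
  intro r hr
  obtain ⟨g, hgc, hgf, hgcont, hgL⟩ := (Lp.memLp f).exists_hasCompactSupport_eLpNorm_sub_le hp'
    (ε := ENNReal.ofReal (r / (3 * (C + 1)))) 
    (by simp only [ne_eq, ENNReal.ofReal_eq_zero, not_le]; positivity)
  set u := hgL.toLp g with hu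
  have hfu : ‖f - u‖ ≤ r / (3 * (C + 1)) := by
    have h1 : eLpNorm (⇑(f - u)) p (volume.restrict Ω) = eLpNorm (⇑f - g) p (volume.restrict Ω) :=
      eLpNorm_congr_ae ((Lp.coeFn_sub f u).trans (EventuallyEq.rfl.sub hgL.coeFn_toLp))
    rw [Lp.norm_def, h1]
    exact ENNReal.toReal_le_of_le_ofReal (by positivity) hgf
  -- convergence on continuous functions with compact support
  obtain ⟨G, hG⟩ := hgcont.bounded_above_of_compact_support hgc
  -- `m = |Ω|^(1/p)` converts a uniform bound on `Ω` into an `L^p` bound. The two errors, from `P n`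
  -- and from the oscillation of `g`, are each at most `r / (6 (m + 1))`, so together they
  -- contribute at most `r / 3`.
  set m : ℝ := measureUnivNNReal (volume.restrict Ω) ^ (p.toReal)⁻¹ with hm
  have hm0 : 0 ≤ m := by positivity
  have hω : 0 < r / (6 * (m + 1)) := by positivity
  obtain ⟨δ, hδ, hunif⟩ := Metric.uniformContinuous_iff.1
    (hgc.uniformContinuous_of_continuous hgcont) _ hω
  have hεG : ∀ᶠ n in atTop, ε n * G < r / (6 * (m + 1)) := by
    have : Tendsto (fun n => ε n * G) atTop (𝓝 (0 * G)) := hε.mul_const G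
    rw [zero_mul] at this
    exact this.eventually (gt_mem_nhds hω)
  have hconv : ∀ᶠ n in atTop, ‖S n u - u‖ < r / 2 := by
    filter_upwards [hschur, hS, hh, hεG, hτ.eventually (gt_mem_nhds hδ), hP, hhτ]
      with n h1 h2 h3 h4 h5 hP hhτ
    have hae : ∀ᵐ x ∂volume.restrict Ω, ‖(S n u - u : Lp E p (volume.restrict Ω)) x‖
        ≤ r / (6 * (m + 1)) + r / (6 * (m + 1)) := by
      filter_upwards [Lp.coeFn_sub (S n u) u, h2 u, hgL.coeFn_toLp,
        h1.ae_integrable hAt (ENNReal.mul_ne_top hAt hBt) hgL hp hp',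
        ae_restrict_mem hΩ.measurableSet] with x e1 e2 e3 e4 hx
      have e5 : ∫ y in Ω, weightedKernel ρ (hs n) (P n) x y (u y)
          = ∫ y in Ω, weightedKernel ρ (hs n) (P n) x y (g y) := by
        refine integral_congr_ae ?_
        filter_upwards [hgL.coeFn_toLp] with y hy
        rw [hu, hy]
      rw [e1, Pi.sub_apply, e2, e5, hu, e3]
      refine (h3.norm_setIntegral_weightedKernel_sub_le hΩ hρ hx (hP x hx) hG
        (κ := r / (6 * (m + 1))) (fun y hy => ?_) e4).trans (by linarith)
      rw [← dist_eq_norm]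
      refine (hunif ?_).le
      rw [dist_comm]
      exact hy.trans_le ((hhτ x hx).trans h5.le)
    refine (Lp.norm_le_of_ae_bound (by positivity) hae).trans_lt ?_
    rw [← hm]
    calc m * (r / (6 * (m + 1)) + r / (6 * (m + 1))) = (m / (m + 1)) * (r / 3) := by
          field_simp; ring
      _ ≤ 1 * (r / 3) := by
          gcongr
          rw [div_le_one (by positivity)]
          linarith
      _ < r / 2 := by linarith
  have hev : ∀ᶠ n in atTop, dist (S n f) f < r := by
    filter_upwards [hbound, hconv] with n h1 h2
    rw [dist_eq_norm]
    have hsplit : S n f - f = S n (f - u) + (S n u - u) - (f - u) := by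
      rw [map_sub]; abel
    have h3 : (C + 1) * ‖f - u‖ ≤ r / 3 := by
      calc (C + 1) * ‖f - u‖ ≤ (C + 1) * (r / (3 * (C + 1))) := by gcongr
        _ = r / 3 := by field_simp
    calc ‖S n f - f‖ ≤ ‖S n (f - u)‖ + ‖S n u - u‖ + ‖f - u‖ := by
          rw [hsplit]
          exact (norm_sub_le _ _).trans (by gcongr; exact norm_add_le _ _)
      _ < r := by have := h1 (f - u); linarith
  obtain ⟨n, hn⟩ := eventually_atTop.1 hev
  exact ⟨n, fun k hk => hn k hk.le⟩

end

/-! ### Weak gradients: classical gradients, uniqueness, closedness -/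

noncomputable section

variable {N : ℕ} {Ω : Set (Eucl N)}

theorem ContDiffOn.continuousOn_gradient {f : Eucl N → ℝ} (hf : ContDiffOn ℝ 1 f Ω)
    (hΩ : IsOpen Ω) : ContinuousOn (gradient f) Ω :=
  (InnerProductSpace.toDual ℝ (Eucl N)).symm.continuous.comp_continuousOn
    (hf.continuousOn_fderiv_of_isOpen hΩ le_rfl)

theorem integrable_mul_of_tsupport_subset {u ψ : Eucl N → ℝ} (hΩ : IsOpen Ω)
    (hu : ContinuousOn u Ω) (hψ : Continuous ψ) (hc : HasCompactSupport ψ)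
    (hs : tsupport ψ ⊆ Ω) : Integrable fun x => u x * ψ x := by
  refine Continuous.integrable_of_hasCompactSupport ?_ hc.mul_left
  refine (hu.mul hψ.continuousOn).continuous_of_tsupport_subset hΩ ?_
  exact (tsupport_mul_subset_right).trans hs

/-- The gradient of a `C^1` function is its weak gradient. -/
theorem isWeakGradient_gradient {f : Eucl N → ℝ} (hΩ : IsOpen Ω) (hf : ContDiffOn ℝ 1 f Ω) :
    IsWeakGradient Ω f (gradient f) := by
  intro φ hφ hφc hφs v
  have hd : Continuous fun x => fderiv ℝ φ x v :=
    (hφ.continuous_fderiv (by simp)).clm_apply continuous_const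
  have hdc : HasCompactSupport fun x => fderiv ℝ φ x v := hφc.fderiv_apply (𝕜 := ℝ) v
  have hds : tsupport (fun x => fderiv ℝ φ x v) ⊆ Ω :=
    (tsupport_fderiv_apply_subset ℝ v).trans hφs
  have hf' : ContinuousOn (fun x => fderiv ℝ f x v) Ω :=
    (hf.continuousOn_fderiv_of_isOpen hΩ le_rfl).clm_apply continuousOn_const
  rw [setIntegral_eq_integral_of_forall_compl_eq_zero,
    setIntegral_eq_integral_of_forall_compl_eq_zero]
  · simp only [inner_gradient_left]
    simp only [mul_comm (φ _)]
    exact integral_mul_fderiv_eq_neg_fderiv_mul_of_integrable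
      (integrable_mul_of_tsupport_subset hΩ hf' hφ.continuous hφc hφs)
      (integrable_mul_of_tsupport_subset hΩ hf.continuousOn hd hdc hds)
      (integrable_mul_of_tsupport_subset hΩ hf.continuousOn hφ.continuous hφc hφs)
      (fun x hx => ((hf.differentiableOn one_ne_zero) x (hφs hx)).differentiableAt
        (hΩ.mem_nhds (hφs hx)))
      (fun x _ => (hφ.differentiable (by simp)) x)
  · intro x hx
    rw [image_eq_zero_of_notMem_tsupport fun h => hx (hφs h), zero_mul]
  · intro x hx
    rw [image_eq_zero_of_notMem_tsupport fun h => hx (hds h), mul_zero]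

/-- Weak gradients are unique. -/
theorem IsWeakGradient.ae_eq {u : Eucl N → ℝ} {g g' : Eucl N → Eucl N} (hΩ : IsOpen Ω)
    (h : IsWeakGradient Ω u g) (h' : IsWeakGradient Ω u g') (hg : LocallyIntegrableOn g Ω)
    (hg' : LocallyIntegrableOn g' Ω) : g =ᵐ[volume.restrict Ω] g' := by
  -- Fundamental lemma of the calculus of variations for the vector field `g - g'`; the vanishing of
  -- the integral is tested against each direction `v`.
  have key := hΩ.ae_eq_zero_of_integral_contDiff_smul_eq_zero (μ := volume) (hg.sub hg')
    (fun φ hφ hφc hφs => ?_)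
  · rw [EventuallyEq, ae_restrict_iff' hΩ.measurableSet]
    filter_upwards [key] with x hx hxΩ
    exact sub_eq_zero.1 (hx hxΩ)
  · have hint : ∀ {G : Eucl N → Eucl N}, LocallyIntegrableOn G Ω →
        IntegrableOn (fun x => φ x • G x) Ω := by
      intro G hG
      have := (hG.integrableOn_compact_subset hφs hφc).continuousOn_smul hφ.continuous.continuousOn
        hφc
      have h2 : Integrable fun x => φ x • G x := by
        rw [integrableOn_iff_integrable_of_support_subset] at this
        · exact this
        · intro x hx
          by_contra hc
          exact hx (by simp [image_eq_zero_of_notMem_tsupport hc])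
      exact h2.integrableOn
    rw [← setIntegral_eq_integral_of_forall_compl_eq_zero (s := Ω)]
    · refine ext_inner_left ℝ fun v => ?_
      simp only [Pi.sub_apply, smul_sub]
      rw [integral_sub (hint hg) (hint hg'), inner_sub_right, inner_zero_right,
        ← integral_inner (hint hg), ← integral_inner (hint hg'), sub_eq_zero]
      have e := (h φ hφ hφc hφs v).symm.trans (h' φ hφ hφc hφs v)
      have hcomm : ∀ (G : Eucl N → Eucl N) x, inner ℝ v (φ x • G x) = φ x * inner ℝ (G x) v :=
        fun G x => by rw [inner_smul_right, real_inner_comm]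
      simp only [hcomm]
      exact neg_injective e
    · intro x hx
      rw [image_eq_zero_of_notMem_tsupport fun h => hx (hφs h), zero_smul]

/-- `W^{1,p}(Ω)` is closed in `L^p × L^p`. -/
theorem isClosed_sobolevW1 {p : ℝ≥0∞} [Fact (1 ≤ p)] :
    IsClosed (SobolevW1 Ω p : Set (LpPair Ω p)) := by
  set μ := volume.restrict Ω
  have hq : ENNReal.HolderConjugate p p.conjExponent :=
    ENNReal.HolderConjugate.conjExponent Fact.out
  set q := p.conjExponent
  have hq1 : Fact (1 ≤ q) := ⟨hq.symm.one_le⟩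
  -- Each pair of a test function and a direction gives one equation between Hölder pairings with
  -- fixed elements of `L^q`, hence a closed condition.
  have hset : (SobolevW1 Ω p : Set (LpPair Ω p)) =
      ⋂ (φ : Eucl N → ℝ) (_ : ContDiff ℝ ∞ φ) (_ : HasCompactSupport φ) (_ : tsupport φ ⊆ Ω)
        (v : Eucl N), {w : LpPair Ω p | ∫ x in Ω, w.fst x * fderiv ℝ φ x v
          = - ∫ x in Ω, φ x * inner ℝ (w.snd x) v} := by
    ext w
    simp only [mem_iInter]
    rfl
  rw [hset]
  refine isClosed_iInter fun φ => isClosed_iInter fun hφ => isClosed_iInter fun hφc =>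
    isClosed_iInter fun _ => isClosed_iInter fun v => ?_
  have hd : Continuous fun x => fderiv ℝ φ x v :=
    (hφ.continuous_fderiv (by simp)).clm_apply continuous_const
  have hdc : HasCompactSupport fun x => fderiv ℝ φ x v := hφc.fderiv_apply (𝕜 := ℝ) v
  have hψ : MemLp (fun x => fderiv ℝ φ x v) q μ := hd.memLp_of_hasCompactSupport hdc
  have hφv : MemLp (fun x => φ x • v) q μ :=
    (hφ.continuous.smul continuous_const).memLp_of_hasCompactSupport hφc.smul_right
  have h1 : Continuous fun w : LpPair Ω p => ∫ x in Ω, w.fst x * fderiv ℝ φ x v := by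
    have hc := (((ContinuousLinearMap.mul ℝ ℝ).lpPairing μ p q).flip (hψ.toLp _)).continuous.comp
      (WithLp.continuous_fst p (Lp ℝ p μ) (Lp (Eucl N) p μ))
    refine hc.congr fun w => ?_
    simp only [Function.comp_apply, ContinuousLinearMap.flip_apply,
      ContinuousLinearMap.lpPairing_eq_integral]
    refine integral_congr_ae ?_
    filter_upwards [hψ.coeFn_toLp] with x hx
    rw [hx]
    rfl
  have h2 : Continuous fun w : LpPair Ω p => ∫ x in Ω, φ x * inner ℝ (w.snd x) v := by
    have hc := (((innerSL ℝ (E := Eucl N)).lpPairing μ p q).flip (hφv.toLp _)).continuous.comp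
      (WithLp.continuous_snd p (Lp ℝ p μ) (Lp (Eucl N) p μ))
    refine hc.congr fun w => ?_
    simp only [Function.comp_apply, ContinuousLinearMap.flip_apply,
      ContinuousLinearMap.lpPairing_eq_integral]
    refine integral_congr_ae ?_
    filter_upwards [hφv.coeFn_toLp] with x hx
    rw [hx, innerSL_apply_apply, inner_smul_right]
  exact isClosed_eq h1 h2.neg

end

/-! ### Mollification of functions regular on `Ω`: gradient, smoothness, support -/

noncomputable section

variable {N : ℕ} {ρ : Eucl N → ℝ} {Ω : Set (Eucl N)} {h : Eucl N → ℝ}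

/-- The factor `P(x, z) g = g - ⟨z, g⟩ ∇h(x)` in the gradient of the variable step
mollification. -/
def gradientFactor (h : Eucl N → ℝ) (x z : Eucl N) : Eucl N →L[ℝ] Eucl N :=
  ContinuousLinearMap.id ℝ (Eucl N) - (innerSL ℝ z).smulRight (gradient h x)

theorem gradientFactor_apply (x z g : Eucl N) :
    gradientFactor h x z g = g - inner ℝ z g • gradient h x := by
  simp [gradientFactor]

theorem norm_gradient (x : Eucl N) : ‖gradient h x‖ = ‖fderiv ℝ h x‖ := by
  rw [gradient, LinearIsometryEquiv.norm_map]

theorem norm_gradientFactor_sub_id_le {x z : Eucl N} (hz : ‖z‖ < 1) {C : ℝ}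
    (hC : ‖fderiv ℝ h x‖ ≤ C) :
    ‖gradientFactor h x z - ContinuousLinearMap.id ℝ (Eucl N)‖ ≤ C := by
  rw [gradientFactor, sub_sub_cancel_left, norm_neg, ContinuousLinearMap.norm_smulRight_apply,
    innerSL_apply_norm, norm_gradient]
  exact (mul_le_of_le_one_left (norm_nonneg _) hz.le).trans hC

theorem norm_gradientFactor_le {x z : Eucl N} (hz : ‖z‖ < 1) {C : ℝ}
    (hC : ‖fderiv ℝ h x‖ ≤ C) : ‖gradientFactor h x z‖ ≤ C + 1 := by
  have h1 := norm_add_le (gradientFactor h x z - ContinuousLinearMap.id ℝ (Eucl N))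
    (ContinuousLinearMap.id ℝ (Eucl N))
  rw [sub_add_cancel] at h1
  exact h1.trans (add_le_add (norm_gradientFactor_sub_id_le hz hC) ContinuousLinearMap.norm_id_le)

namespace IsStepFunction

theorem continuous_gradient {Θ : Set (Eucl N)} (hh : IsStepFunction Θ h) :
    Continuous (gradient h) :=
  (InnerProductSpace.toDual ℝ (Eucl N)).symm.continuous.comp
    (hh.smooth.continuous_fderiv (by simp))

theorem continuous_gradientFactor {Θ : Set (Eucl N)} (hh : IsStepFunction Θ h) :
    Continuous (Function.uncurry (gradientFactor h)) := by
  have h1 : Continuous fun q : Eucl N × Eucl N => innerSL ℝ q.2 :=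
    (innerSL ℝ).continuous.comp continuous_snd
  have h2 : Continuous fun q : Eucl N × Eucl N => gradient h q.1 :=
    hh.continuous_gradient.comp continuous_fst
  have h3 := (ContinuousLinearMap.smulRightL ℝ (Eucl N)
    (Eucl N)).isBoundedBilinearMap.continuous.comp (h1.prodMk h2)
  exact continuous_const.sub h3

theorem sub_smul_mem (hh : IsStepFunction (frontier Ω) h) (hΩ : IsOpen Ω) {x z : Eucl N}
    (hx : x ∈ Ω) (hz : ‖z‖ ≤ 1) : x - h x • z ∈ Ω := by
  refine hh.closedBall_subset hΩ hx ?_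
  rw [Metric.mem_closedBall, dist_eq_norm, sub_sub_cancel_left, norm_neg, norm_smul,
    Real.norm_of_nonneg (hh.nonneg x)]
  exact mul_le_of_le_one_right (hh.nonneg x) hz

theorem variableMollify_eq (hh : IsStepFunction (frontier Ω) h) (hΩ : IsOpen Ω)
    (hρ : IsMollifierKernel ρ) (f : Eucl N → ℝ) {x : Eucl N} (hx : x ∈ Ω) :
    variableMollify ρ h f x = ∫ y in Ω, stepKernel ρ h x y * f y := by
  have := hh.kernelConst_smul_setIntegral hΩ hρ hx f
  simp only [smul_eq_mul] at this
  exact this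

/-- Chain rule: the map `x ↦ x - h(x) z` has derivative `v ↦ v - ⟨∇h(x), v⟩ z`, whose adjoint is
`gradientFactor h x z`. -/
theorem hasFDerivAt_comp_sub_smul {Θ : Set (Eucl N)} (hh : IsStepFunction Θ h)
    {f : Eucl N → ℝ} {x z : Eucl N} (hf : DifferentiableAt ℝ f (x - h x • z)) :
    HasFDerivAt (fun x => ρ z * f (x - h x • z))
      (InnerProductSpace.toDual ℝ (Eucl N)
        (ρ z • gradientFactor h x z (gradient f (x - h x • z)))) x := by
  have h1 : HasFDerivAt h (fderiv ℝ h x) x :=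
    (hh.smooth.differentiable (by simp)).differentiableAt.hasFDerivAt
  have h2 : HasFDerivAt (fun x => x - h x • z)
      (ContinuousLinearMap.id ℝ (Eucl N) - (fderiv ℝ h x).smulRight z) x :=
    (hasFDerivAt_id x).sub (h1.smul_const z)
  have h3 := (hf.hasFDerivAt.comp x h2).const_mul (ρ z)
  refine h3.congr_fderiv ?_
  ext v
  simp only [InnerProductSpace.toDual_apply_apply, inner_smul_left, gradientFactor_apply,
    inner_sub_left, inner_gradient_left, RCLike.conj_to_real]
  rw [real_inner_comm, inner_gradient_left]
  simp only [smul_apply, ContinuousLinearMap.comp_apply,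
    sub_apply, ContinuousLinearMap.smulRight_apply,
    ContinuousLinearMap.id_apply, map_sub, map_smul, smul_eq_mul]
  ring

/-- The gradient of the variable step mollification of a `C^1` function. -/
theorem hasGradientAt_variableMollify (hh : IsStepFunction (frontier Ω) h) (hΩ : IsOpen Ω)
    (hρ : IsMollifierKernel ρ) {f : Eucl N → ℝ} (hf : ContDiffOn ℝ 1 f Ω) {x : Eucl N}
    (hx : x ∈ Ω) :
    HasGradientAt (variableMollify ρ h f)
      (∫ y in Ω, weightedKernel ρ h (gradientFactor h) x y (gradient f y)) x := by
  have hgrad := hf.continuousOn_gradient hΩ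
  have hhc := hh.smooth.continuous
  have hρc := hρ.continuous
  -- For base points in a compact ball inside `Ω` and `z` in the closed unit ball, the points `x -
  -- h(x) z` fill a compact subset of `Ω`. Continuity alone then gives a constant dominating the
  -- derivative, with no global bound on `∇f`.
  obtain ⟨r, hr, hrΩ⟩ := Metric.nhds_basis_closedBall.mem_iff.1 (hΩ.mem_nhds hx)
  set K : Set (Eucl N × Eucl N) :=
    Metric.closedBall x r ×ˢ Metric.closedBall (0 : Eucl N) 1 with hK
  have hKc : IsCompact K := (isCompact_closedBall x r).prod (isCompact_closedBall 0 1)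
  have hmaps : MapsTo (fun q : Eucl N × Eucl N => q.1 - h q.1 • q.2) K Ω := fun q hq =>
    hh.sub_smul_mem hΩ (hrΩ hq.1) (mem_closedBall_zero_iff.1 hq.2)
  have hmc : Continuous fun q : Eucl N × Eucl N => q.1 - h q.1 • q.2 := by fun_prop
  set G : Eucl N → Eucl N → Eucl N :=
    fun x z => ρ z • gradientFactor h x z (gradient f (x - h x • z)) with hG
  have hGc : ContinuousOn (Function.uncurry G) K := by
    have h1 := hgrad.comp hmc.continuousOn hmaps
    have h2 := hh.continuous_gradientFactor.continuousOn.clm_apply h1 (s := K)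
    exact (hρc.comp continuous_snd).continuousOn.smul h2
  have hFc : ContinuousOn (Function.uncurry fun x z => ρ z * f (x - h x • z)) K :=
    (hρc.comp continuous_snd).continuousOn.mul (hf.continuousOn.comp hmc.continuousOn hmaps)
  obtain ⟨C, hC⟩ := hKc.exists_bound_of_continuousOn hGc
  obtain ⟨C', hC'⟩ := hKc.exists_bound_of_continuousOn hFc
  have hslice : ∀ {F : Type} [TopologicalSpace F] {u : Eucl N → Eucl N → F},
      ContinuousOn (Function.uncurry u) K → ∀ x' ∈ Metric.closedBall x r,
      ContinuousOn (u x') (Metric.ball (0 : Eucl N) 1) := by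
    intro F _ u hu x' hx'
    exact hu.comp (f := fun z => (x', z)) (by fun_prop)
      (fun z hz => ⟨hx', Metric.ball_subset_closedBall hz⟩)
  have hxr : x ∈ Metric.closedBall x r := Metric.mem_closedBall_self hr.le
  have hmb : MeasurableSet (Metric.ball (0 : Eucl N) 1) := Metric.isOpen_ball.measurableSet
  have : IsFiniteMeasure (volume.restrict (Metric.ball (0 : Eucl N) 1)) :=
    ⟨by rw [Measure.restrict_apply_univ]; exact measure_ball_lt_top⟩
  have key := hasFDerivAt_integral_of_dominated_of_fderiv_le
    (μ := volume.restrict (Metric.ball (0 : Eucl N) 1)) (𝕜 := ℝ)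
    (F := fun x z => ρ z * f (x - h x • z))
    (F' := fun x z => InnerProductSpace.toDual ℝ (Eucl N) (G x z))
    (x₀ := x) (s := Metric.closedBall x r) (bound := fun _ => C)
    (Metric.closedBall_mem_nhds x hr)
    (by
      filter_upwards [Metric.closedBall_mem_nhds x hr] with x' hx'
      exact (hslice hFc x' hx').aestronglyMeasurable hmb)
    (by
      refine Integrable.of_bound ((hslice hFc x hxr).aestronglyMeasurable hmb) C' ?_
      filter_upwards [ae_restrict_mem hmb] with z hz
      exact hC' (x, z) ⟨hxr, Metric.ball_subset_closedBall hz⟩)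
    ((InnerProductSpace.toDual ℝ (Eucl N)).continuous.comp_aestronglyMeasurable
      ((hslice hGc x hxr).aestronglyMeasurable hmb))
    (by
      filter_upwards [ae_restrict_mem hmb] with z hz x' hx'
      rw [LinearIsometryEquiv.norm_map]
      exact hC (x', z) ⟨hx', Metric.ball_subset_closedBall hz⟩)
    (integrable_const C)
    (by
      filter_upwards [ae_restrict_mem hmb] with z hz x' hx'
      have hmem := hmaps (show (x', z) ∈ K from ⟨hx', Metric.ball_subset_closedBall hz⟩)
      exact hh.hasFDerivAt_comp_sub_smul
        ((hf.differentiableOn one_ne_zero _ hmem).differentiableAt (hΩ.mem_nhds hmem)))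
  rw [hh.setIntegral_weightedKernel hΩ hρ _ hx, hasGradientAt_iff_hasFDerivAt, map_smul]
  have hcomm : ∫ z in Metric.ball (0 : Eucl N) 1, InnerProductSpace.toDual ℝ (Eucl N) (G x z)
      = InnerProductSpace.toDual ℝ (Eucl N) (∫ z in Metric.ball (0 : Eucl N) 1, G x z) :=
    (InnerProductSpace.toDual ℝ (Eucl N)).toContinuousLinearEquiv.integral_comp_comm _
  rw [hcomm] at key
  exact key.const_mul (kernelConst ρ)

/-- Variable step mollification produces smooth functions. -/
theorem contDiffOn_variableMollify (hh : IsStepFunction (frontier Ω) h) (hΩ : IsOpen Ω)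
    (hΩb : Bornology.IsBounded Ω) (hρ : IsMollifierKernel ρ) {f : Eucl N → ℝ}
    (hf : IntegrableOn f Ω) : ContDiffOn ℝ ∞ (variableMollify ρ h f) Ω := by
  obtain ⟨C, hC0, hC, -⟩ := hh.exists_bound_fderiv hΩb
  set g : Eucl N → Eucl N → ℝ :=
    fun x w => kernelConst ρ * (h x ^ N)⁻¹ * ρ ((h x)⁻¹ • w) with hg
  have hfi : Integrable (Ω.indicator f) := hf.integrable_indicator hΩ.measurableSet
  have hsm : ContDiffOn ℝ ∞ (fun q : Eucl N × Eucl N => h q.1) (Ω ×ˢ univ) :=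
    (hh.smooth.comp contDiff_fst).contDiffOn
  have hne : ∀ q ∈ Ω ×ˢ (univ : Set (Eucl N)), h q.1 ≠ 0 := fun q hq => (hh.pos hΩ hq.1).ne'
  have hgs : ContDiffOn ℝ ∞ (Function.uncurry g) (Ω ×ˢ univ) := by
    refine (contDiffOn_const.mul ((hsm.pow N).inv fun q hq => pow_ne_zero _ (hne q hq))).mul ?_
    exact hρ.smooth.comp_contDiffOn ((hsm.inv hne).smul contDiff_snd.contDiffOn)
  -- The mollification at `x` is the convolution of `1_Ω f` with `g x`, evaluated at `x`. The
  -- parametrised kernel is smooth because `h > 0` on `Ω`, and `h ≤ C` there gives one compact set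
  -- containing the supports of all `g x`.
  have key := contDiffOn_convolution_right_with_param_comp (μ := volume) (n := ⊤)
    (ContinuousLinearMap.lsmul ℝ ℝ) (v := id) (f := Ω.indicator f) (g := g)
    (k := Metric.closedBall 0 C) contDiffOn_id hΩ (isCompact_closedBall 0 C)
    (fun x w hx hw => ?_) hfi.locallyIntegrable hgs
  · refine key.congr fun x hx => ?_
    rw [hh.variableMollify_eq hΩ hρ f hx, ← integral_indicator hΩ.measurableSet]
    simp only [convolution, id]
    refine integral_congr_ae (Eventually.of_forall fun y => ?_)
    by_cases hy : y ∈ Ω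
    · simp [hy, hg, stepKernel, mul_comm]
    · simp [hy]
  · rw [mem_closedBall_zero_iff, not_le] at hw
    have h0 := hh.pos hΩ hx
    have : ρ ((h x)⁻¹ • w) = 0 := by
      refine hρ.eq_zero ?_
      rw [norm_smul, norm_inv, Real.norm_of_nonneg h0.le, inv_mul_eq_div, one_le_div h0]
      exact (hC x hx).trans hw.le
    simp only [hg, this, mul_zero]

/-- Variable step mollification does not enlarge the set of boundary points touched by the
support. -/
theorem supportIn_variableMollify_inter (hh : IsStepFunction (frontier Ω) h) (hΩ : IsOpen Ω)
    {Γ : Set (Eucl N)} (hΓ : Γ ⊆ frontier Ω) {f : Eucl N → ℝ}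
    (hf : supportIn Ω f ∩ Γ = ∅) : supportIn Ω (variableMollify ρ h f) ∩ Γ = ∅ := by
  refine eq_empty_of_forall_notMem ?_
  rintro b ⟨hb, hbΓ⟩
  have hbf : b ∉ supportIn Ω f := fun hb' =>
    (eq_empty_iff_forall_notMem.1 hf b) ⟨hb', hbΓ⟩
  obtain ⟨r, hr, hrf⟩ := Metric.mem_nhds_iff.1
    ((isClosed_closure : IsClosed (supportIn Ω f)).isOpen_compl.mem_nhds hbf)
  -- Since `b` is a frontier point, `h x < dist x b < r / 2`; all points averaged at `x` therefore
  -- lie within `r` of `b`, where `f` vanishes on `Ω`.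
  obtain ⟨x, ⟨hx, hxne⟩, hxb⟩ := Metric.mem_closure_iff.1 hb (r / 2) (by positivity)
  refine hxne ?_
  have hzero : ∀ z ∈ Metric.ball (0 : Eucl N) 1, ρ z * f (x - h x • z) = 0 := by
    intro z hz
    rw [mem_ball_zero_iff] at hz
    have hmem := hh.sub_smul_mem hΩ hx hz.le
    have hd : dist (x - h x • z) x ≤ h x := by
      rw [dist_eq_norm, sub_sub_cancel_left, norm_neg, norm_smul,
        Real.norm_of_nonneg (hh.nonneg x)]
      exact mul_le_of_le_one_right (hh.nonneg x) hz.le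
    have h1 := hh.lt_infDist hΩ hx
    have h2 := Metric.infDist_le_dist_of_mem (x := x) (hΓ hbΓ)
    rw [dist_comm] at hxb
    have h3 : x - h x • z ∈ Metric.ball b r := by
      rw [Metric.mem_ball]
      have := dist_triangle (x - h x • z) x b
      linarith
    have h4 := hrf h3
    by_contra hne
    exact h4 (subset_closure ⟨hmem, fun h0 => hne (by rw [h0, mul_zero])⟩)
  rw [variableMollify, setIntegral_congr_fun Metric.isOpen_ball.measurableSet hzero]
  simp

end IsStepFunction

end

/-! ### The operators on the Sobolev spaces -/

noncomputable section

variable {N : ℕ} {ρ : Eucl N → ℝ} {Ω : Set (Eucl N)} {h : Eucl N → ℝ} {p : ℝ≥0∞}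
  [Fact (1 ≤ p)]

/-- `T` and `U` are the operators on `L^p` giving the variable step mollification of a function
and the corresponding transformation of its gradient. -/
structure IsMollifyPair (ρ h : Eucl N → ℝ)
    (T : Lp ℝ p (volume.restrict Ω) →L[ℝ] Lp ℝ p (volume.restrict Ω))
    (U : Lp (Eucl N) p (volume.restrict Ω) →L[ℝ] Lp (Eucl N) p (volume.restrict Ω)) :
    Prop where
  fst : ∀ u, T u =ᵐ[volume.restrict Ω] fun x => ∫ y in Ω,
    weightedKernel ρ h (fun _ _ => ContinuousLinearMap.id ℝ ℝ) x y (u y)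
  snd : ∀ g, U g =ᵐ[volume.restrict Ω] fun x => ∫ y in Ω,
    weightedKernel ρ h (gradientFactor h) x y (g y)

/-- The operator on `L^p(Ω) × L^p(Ω; ℝ^N)` acting by `T` and `U` on the two components. -/
def lpPairMap (T : Lp ℝ p (volume.restrict Ω) →L[ℝ] Lp ℝ p (volume.restrict Ω))
    (U : Lp (Eucl N) p (volume.restrict Ω) →L[ℝ] Lp (Eucl N) p (volume.restrict Ω)) :
    LpPair Ω p →L[ℝ] LpPair Ω p :=
  ((WithLp.prodContinuousLinearEquiv p ℝ (Lp ℝ p (volume.restrict Ω))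
    (Lp (Eucl N) p (volume.restrict Ω))).symm : _ →L[ℝ] _).comp
  ((T.prodMap U).comp (WithLp.prodContinuousLinearEquiv p ℝ (Lp ℝ p (volume.restrict Ω))
    (Lp (Eucl N) p (volume.restrict Ω)) : _ →L[ℝ] _))

/-- An operator preserving a submodule `X` of a closed submodule `W` restricts to the closure of
`X` in `W`. -/
theorem ContinuousLinearMap.exists_restrict_topologicalClosure {V : Type*}
    [NormedAddCommGroup V] [NormedSpace ℝ V] {W : Submodule ℝ V} (hW : IsClosed (W : Set V))
    (X : Submodule ℝ W) (A : V →L[ℝ] V)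
    (hA : MapsTo A (Subtype.val '' (X : Set W)) (Subtype.val '' (X : Set W))) :
    ∃ S : X.topologicalClosure →L[ℝ] X.topologicalClosure,
      ∀ w : X.topologicalClosure, ((S w).1 : V) = A w.1 := by
  have hAc := hA.closure A.continuous
  have hsub : closure (Subtype.val '' (X : Set W)) ⊆ (W : Set V) := by
    refine closure_minimal ?_ hW
    rintro _ ⟨w, -, rfl⟩
    exact w.2
  -- The closure of `X` inside `W` is the trace on `W` of its closure in `V`, which `A` preserves.
  have hoff : ∀ w : W, w ∈ X.topologicalClosure ↔ (w : V) ∈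
      closure (Subtype.val '' (X : Set W)) := fun w => by rw [← closure_subtype]; rfl
  let A₁ : X.topologicalClosure →L[ℝ] W :=
    (A.comp (W.subtypeL.comp X.topologicalClosure.subtypeL)).codRestrict _
      fun w => hsub (hAc ((hoff w.1).1 w.2))
  exact ⟨A₁.codRestrict _ fun w => (hoff _).2 (hAc ((hoff w.1).1 w.2)), fun w => rfl⟩

namespace IsStepFunction

theorem exists_isMollifyPair (hh : IsStepFunction (frontier Ω) h) (hΩ : IsOpen Ω)
    (hΩb : Bornology.IsBounded Ω) (hρ : IsMollifierKernel ρ) (hp : 1 < p) (hp' : p ≠ ⊤) :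
    ∃ (T : Lp ℝ p (volume.restrict Ω) →L[ℝ] Lp ℝ p (volume.restrict Ω))
      (U : Lp (Eucl N) p (volume.restrict Ω) →L[ℝ] Lp (Eucl N) p (volume.restrict Ω)),
      IsMollifyPair ρ h T U := by
  obtain ⟨C, -, -, hC, -⟩ := hh.exists_bound_fderiv hΩb
  obtain ⟨B, hBt, hB⟩ := hh.exists_lintegral_stepKernel_left_le hΩ hΩb hρ
  have h1 := hh.isSchurKernel_weightedKernel hΩ hρ
    (P := fun _ _ => ContinuousLinearMap.id ℝ ℝ) continuous_const (C := 1)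
    (fun _ _ _ _ => ContinuousLinearMap.norm_id_le) hB
  have h2 := hh.isSchurKernel_weightedKernel hΩ hρ hh.continuous_gradientFactor
    (fun x hx z hz => norm_gradientFactor_le hz (hC x hx)) hB
  obtain ⟨T, hT, -⟩ := h1.exists_clm ENNReal.ofReal_ne_top
    (ENNReal.mul_ne_top ENNReal.ofReal_ne_top hBt) hp hp'
  obtain ⟨U, hU, -⟩ := h2.exists_clm ENNReal.ofReal_ne_top
    (ENNReal.mul_ne_top ENNReal.ofReal_ne_top hBt) hp hp'
  exact ⟨T, U, hT, hU⟩

variable {T : Lp ℝ p (volume.restrict Ω) →L[ℝ] Lp ℝ p (volume.restrict Ω)}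
  {U : Lp (Eucl N) p (volume.restrict Ω) →L[ℝ] Lp (Eucl N) p (volume.restrict Ω)}

/-- For `x ∈ Ω` the mollification is an integral over `Ω` against a kernel, so it depends only on
the class of `f`. -/
theorem variableMollify_ae_eq (hh : IsStepFunction (frontier Ω) h) (hΩ : IsOpen Ω)
    (hρ : IsMollifierKernel ρ) (hTU : IsMollifyPair ρ h T U) {f : Eucl N → ℝ}
    {u : Lp ℝ p (volume.restrict Ω)} (hf : f =ᵐ[volume.restrict Ω] u) :
    variableMollify ρ h f =ᵐ[volume.restrict Ω] T u := by
  filter_upwards [hTU.fst u, ae_restrict_mem hΩ.measurableSet] with x h1 hx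
  rw [h1, hh.variableMollify_eq hΩ hρ f hx]
  refine integral_congr_ae ?_
  filter_upwards [hf] with y hy
  rw [hy]
  rfl

/-- The mollification operators map smooth functions with support off `Γ` to such functions. -/
theorem toLp_mem_smoothOff (hh : IsStepFunction (frontier Ω) h) (hΩ : IsOpen Ω)
    (hΩb : Bornology.IsBounded Ω) (hρ : IsMollifierKernel ρ) (hTU : IsMollifyPair ρ h T U)
    {Γ : Set (Eucl N)} (hΓ : Γ ⊆ frontier Ω) {w : SobolevW1 Ω p}
    (hw : w ∈ smoothOffSubmodule Ω p Γ) :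
    (WithLp.toLp p (T (w : LpPair Ω p).fst, U (w : LpPair Ω p).snd) : LpPair Ω p)
      ∈ Subtype.val '' (smoothOffSubmodule Ω p Γ : Set (SobolevW1 Ω p)) := by
  have : IsFiniteMeasure (volume.restrict Ω) :=
    ⟨by rw [Measure.restrict_apply_univ]; exact hΩb.measure_lt_top⟩
  obtain ⟨f, hf, hfΓ, hfw⟩ := hw
  have hf1 : ContDiffOn ℝ 1 f Ω := hf.of_le (by exact_mod_cast le_top)
  -- Uniqueness of weak gradients identifies the abstract second component with the classical
  -- gradient, to which the differentiation formula applies.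
  have hgrad : (w : LpPair Ω p).snd =ᵐ[volume.restrict Ω] gradient f := by
    have hwf : IsWeakGradient Ω f (w : LpPair Ω p).snd := by
      have hw' : IsWeakGradient Ω (w : LpPair Ω p).fst (w : LpPair Ω p).snd := w.2
      exact hw'.congr hfw EventuallyEq.rfl
    refine hwf.ae_eq hΩ (isWeakGradient_gradient hΩ hf1) ?_ ?_
    · have : IntegrableOn (w : LpPair Ω p).snd Ω := (Lp.memLp _).integrable Fact.out
      exact this.locallyIntegrableOn
    · exact (hf1.continuousOn_gradient hΩ).locallyIntegrableOn hΩ.measurableSet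
  have hfi : IntegrableOn f Ω :=
    ((Lp.memLp (w : LpPair Ω p).fst).integrable Fact.out).congr hfw.symm
  have hsm := hh.contDiffOn_variableMollify hΩ hΩb hρ hfi
  have hrep := hh.variableMollify_ae_eq hΩ hρ hTU hfw
  have hU : U (w : LpPair Ω p).snd =ᵐ[volume.restrict Ω]
      gradient (variableMollify ρ h f) := by
    filter_upwards [hTU.snd (w : LpPair Ω p).snd, ae_restrict_mem hΩ.measurableSet] with x h1 hx
    rw [h1, (hh.hasGradientAt_variableMollify hΩ hρ hf1 hx).gradient]
    refine integral_congr_ae ?_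
    filter_upwards [hgrad] with y hy
    rw [hy]
  refine ⟨⟨WithLp.toLp p (T (w : LpPair Ω p).fst, U (w : LpPair Ω p).snd), ?_⟩,
    ⟨variableMollify ρ h f, hsm, hh.supportIn_variableMollify_inter hΩ hΓ hfΓ, hrep⟩, rfl⟩
  exact (isWeakGradient_gradient hΩ (hsm.of_le (by exact_mod_cast le_top))).congr hrep.symm hU

/-- The mollification operator on `W_Γ^{1,p}(Ω)`. -/
theorem exists_sobolevOperator (hh : IsStepFunction (frontier Ω) h) (hΩ : IsOpen Ω)
    (hΩb : Bornology.IsBounded Ω) (hρ : IsMollifierKernel ρ) (hTU : IsMollifyPair ρ h T U)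
    {Γ : Set (Eucl N)} (hΓ : Γ ⊆ frontier Ω) :
    ∃ S : SobolevW1Off Ω p Γ →L[ℝ] SobolevW1Off Ω p Γ,
      ∀ w : SobolevW1Off Ω p Γ, ((S w).1 : LpPair Ω p) = lpPairMap T U w.1 := by
  refine ContinuousLinearMap.exists_restrict_topologicalClosure isClosed_sobolevW1
    (smoothOffSubmodule Ω p Γ) (lpPairMap T U) ?_
  rintro _ ⟨w, hw, rfl⟩
  exact hh.toLp_mem_smoothOff hΩ hΩb hρ hTU hΓ hw

theorem represents_variableMollify (hh : IsStepFunction (frontier Ω) h) (hΩ : IsOpen Ω)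
    (hρ : IsMollifierKernel ρ) (hTU : IsMollifyPair ρ h T U) {f : Eucl N → ℝ}
    {w w' : SobolevW1 Ω p} (hw : (w' : LpPair Ω p) = lpPairMap T U w) (hf : Represents f w) :
    Represents (variableMollify ρ h f) w' := by
  have h1 : (w' : LpPair Ω p).fst = T (w : LpPair Ω p).fst := congrArg WithLp.fst hw
  rw [Represents, h1]
  exact hh.variableMollify_ae_eq hΩ hρ hTU hf

end IsStepFunction

theorem IsStepFunction.norm_fderiv_div_nat {Θ : Set (Eucl N)} (hh : IsStepFunction Θ h) (n : ℕ)
    (x : Eucl N) : ‖fderiv ℝ (fun x => h x / n) x‖ = ‖fderiv ℝ h x‖ / n := by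
  have h1 := ((hh.smooth.differentiable (by simp)).differentiableAt (x := x)).hasFDerivAt.mul_const
    ((n : ℝ)⁻¹)
  simp only [← div_eq_mul_inv] at h1
  rw [h1.fderiv, norm_smul, norm_inv, Real.norm_natCast, inv_mul_eq_div]

/-- Mollification with step `η / n` converges strongly to the identity on
`L^p(Ω) × L^p(Ω; ℝ^N)`. -/
theorem IsStepFunction.tendsto_lpPairMap {η : Eucl N → ℝ} (hη : IsStepFunction (frontier Ω) η)
    (hΩ : IsOpen Ω) (hΩb : Bornology.IsBounded Ω) (hρ : IsMollifierKernel ρ) (hp : 1 < p)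
    (hp' : p ≠ ⊤) {T : ℕ → Lp ℝ p (volume.restrict Ω) →L[ℝ] Lp ℝ p (volume.restrict Ω)}
    {U : ℕ → Lp (Eucl N) p (volume.restrict Ω) →L[ℝ] Lp (Eucl N) p (volume.restrict Ω)}
    (hTU : ∀ n : ℕ, 1 ≤ n → IsMollifyPair ρ (fun x => η x / n) (T n) (U n)) (w : LpPair Ω p) :
    Tendsto (fun n => lpPairMap (T n) (U n) w) atTop (𝓝 w) := by
  obtain ⟨C, hC0, hηC, hdC, hlip⟩ := hη.exists_bound_fderiv hΩb
  have hlarge : ∀ᶠ n : ℕ in atTop, 1 ≤ n := eventually_ge_atTop 1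
  have hCn : Tendsto (fun n : ℕ => C / n) atTop (𝓝 0) := tendsto_const_div_atTop_nhds_zero_nat C
  have hstep : ∀ᶠ n : ℕ in atTop, IsStepFunction (frontier Ω) (fun x => η x / n) :=
    hlarge.mono fun n hn => hη.div_nat hn
  have hτ : ∀ᶠ n : ℕ in atTop, ∀ x ∈ Ω, η x / n ≤ C / n :=
    Eventually.of_forall fun n x hx => by
      have := hηC x hx
      gcongr
  -- This bound does not depend on `n`: once `C / n < 1 / 2`, the step `η / n` is 1/2-Lipschitz on
  -- all of `Ω`, so no separate treatment of the interior is needed.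
  have hBt : ENNReal.ofReal (kernelConst ρ * 3 ^ N) * volume (Metric.ball (0 : Eucl N) 1) ≠ ⊤ :=
    ENNReal.mul_ne_top ENNReal.ofReal_ne_top measure_ball_lt_top.ne
  have hB : ∀ᶠ n : ℕ in atTop, ∀ y ∈ Ω,
      ∫⁻ x in Ω, ENNReal.ofReal (stepKernel ρ (fun x => η x / n) x y)
        ≤ ENNReal.ofReal (kernelConst ρ * 3 ^ N) * volume (Metric.ball (0 : Eucl N) 1) := by
    filter_upwards [hstep, hCn.eventually (gt_mem_nhds (one_half_pos (α := ℝ)))]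
      with n h1 h2 y hy
    refine h1.setLIntegral_stepKernel_left_le hΩ hρ Subset.rfl hΩ.measurableSet
      (fun x hx y hy _ => ?_) hy
    have h3 := hlip x hx y hy
    rw [← sub_div, abs_div, Nat.abs_cast]
    calc |η x - η y| / n ≤ C * dist x y / n := by gcongr
      _ = C / n * dist x y := by ring
      _ ≤ 1 / 2 * dist x y := by gcongr
  have hT : Tendsto (fun n => T n w.fst) atTop (𝓝 w.fst) :=
    tendsto_of_weightedKernel hΩ hΩb hρ hp hp' hstep
      (P := fun _ _ _ => ContinuousLinearMap.id ℝ ℝ)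
      (Eventually.of_forall fun _ => continuous_const) tendsto_const_nhds hCn hτ
      (ε := fun _ => 0) (Eventually.of_forall fun _ _ _ _ _ => by simp) hBt hB
      (hlarge.mono fun n hn => (hTU n hn).fst) _
  have hU : Tendsto (fun n => U n w.snd) atTop (𝓝 w.snd) :=
    tendsto_of_weightedKernel hΩ hΩb hρ hp hp' hstep
      (P := fun n => gradientFactor (fun x => η x / n))
      (hstep.mono fun n hn => hn.continuous_gradientFactor) hCn hCn hτ
      (Eventually.of_forall fun n x hx z hz => norm_gradientFactor_sub_id_le hz (by
        rw [hη.norm_fderiv_div_nat]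
        have := hdC x hx
        gcongr)) hBt hB
      (hlarge.mono fun n hn => (hTU n hn).snd) _
  exact ((WithLp.prodContinuousLinearEquiv p ℝ (Lp ℝ p (volume.restrict Ω))
    (Lp (Eucl N) p (volume.restrict Ω))).symm.continuous.tendsto _).comp (hT.prodMk_nhds hU)

/-- Mollification with step `η / n` converges strongly to the identity on `W_Γ^{1,p}(Ω)`. -/
theorem IsStepFunction.exists_tendsto_represents {η : Eucl N → ℝ}
    (hη : IsStepFunction (frontier Ω) η)
    (hΩ : IsOpen Ω) (hΩb : Bornology.IsBounded Ω) (hρ : IsMollifierKernel ρ) (hp : 1 < p)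
    (hp' : p ≠ ⊤) {Γ : Set (Eucl N)} (hΓ : Γ ⊆ frontier Ω) (w : SobolevW1Off Ω p Γ) :
    ∃ W : ℕ → SobolevW1Off Ω p Γ,
      (∀ n : ℕ, 1 ≤ n → ∀ f : Eucl N → ℝ, Represents f w.1 →
        Represents (variableMollifySeq ρ η n f) (W n).1) ∧
      Tendsto W atTop (𝓝 w) := by
  have hex : ∀ n : ℕ, ∃ (T : Lp ℝ p (volume.restrict Ω) →L[ℝ] Lp ℝ p (volume.restrict Ω))
      (U : Lp (Eucl N) p (volume.restrict Ω) →L[ℝ] Lp (Eucl N) p (volume.restrict Ω)),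
      1 ≤ n → IsMollifyPair ρ (fun x => η x / n) T U := by
    intro n
    by_cases hn : 1 ≤ n
    · obtain ⟨T, U, hTU⟩ := (hη.div_nat hn).exists_isMollifyPair hΩ hΩb hρ hp hp'
      exact ⟨T, U, fun _ => hTU⟩
    · exact ⟨0, 0, fun h => absurd h hn⟩
  choose T U hTU using hex
  have hW : ∀ n : ℕ, ∃ v : SobolevW1Off Ω p Γ,
      1 ≤ n → (v.1 : LpPair Ω p) = lpPairMap (T n) (U n) w.1 := by
    intro n
    by_cases hn : 1 ≤ n
    · have h1 := (hη.div_nat hn).exists_sobolevOperator hΩ hΩb hρ (hTU n hn) hΓ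
      exact h1.elim fun S hS => ⟨S w, fun _ => hS w⟩
    · exact ⟨0, fun h => absurd h hn⟩
  choose W hW using hW
  refine ⟨W, fun n hn f hf => (hη.div_nat hn).represents_variableMollify hΩ hρ (hTU n hn)
    (hW n hn) hf, ?_⟩
  -- `SobolevW1Off` is a subspace of a subspace, so convergence is tested in `L^p × L^p`.
  rw [tendsto_subtype_rng, tendsto_subtype_rng]
  refine (hη.tendsto_lpPairMap hΩ hΩb hρ hp hp' hTU w.1).congr' ?_
  filter_upwards [eventually_ge_atTop 1] with n hn
  exact (hW n hn).symm

end

/-- Quantifying over every representative `f` also records that the mollified class does not depend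
on the choice of `f`. -/
theorem proposition4p2 {N : ℕ} (hN : 1 ≤ N)
    (Ω : Set (Eucl N)) (hΩo : IsOpen Ω) (hΩb : Bornology.IsBounded Ω) (hΩn : Ω.Nonempty)
    (ρ : Eucl N → ℝ) (hρ : IsMollifierKernel ρ)
    (η : Eucl N → ℝ) (hη : IsStepFunction (frontier Ω) η)
    (Γ : Set (Eucl N)) (hΓc : IsClosed Γ) (hΓ : Γ ⊆ frontier Ω)
    (p : ℝ≥0∞) [Fact (1 ≤ p)] (hp : 1 < p) (hp' : p < ⊤) :
    -- `T` is a bounded linear operator on `W_Γ^{1,p}(Ω)`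
    (∃ S : SobolevW1Off Ω p Γ →L[ℝ] SobolevW1Off Ω p Γ,
      ∀ (w : SobolevW1Off Ω p Γ) (f : Eucl N → ℝ), Represents f w.1 →
        Represents (variableMollify ρ η f) (S w).1) ∧
    -- for `w ∈ W_Γ^{1,p}(Ω)`, `T_n w ∈ W_Γ^{1,p}(Ω)` and `T_n w → w` in `W_Γ^{1,p}(Ω)`
    (∀ w : SobolevW1Off Ω p Γ, ∃ W : ℕ → SobolevW1Off Ω p Γ,
      (∀ n : ℕ, 1 ≤ n → ∀ f : Eucl N → ℝ, Represents f w.1 →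
        Represents (variableMollifySeq ρ η n f) (W n).1) ∧
      Tendsto W atTop (𝓝 w)) := by
  refine ⟨?_, fun w => hη.exists_tendsto_represents hΩo hΩb hρ hp hp'.ne hΓ w⟩
  obtain ⟨T, U, hTU⟩ := hη.exists_isMollifyPair hΩo hΩb hρ hp hp'.ne
  exact (hη.exists_sobolevOperator hΩo hΩb hρ hTU hΓ).imp fun S hS w f hf =>
    hη.represents_variableMollify hΩo hρ hTU (hS w) hf
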